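/- Let $r\in[2,\infty)$, $r'=r/(r-1)$, and $s,M\in\mathbb R$. A real or complex random variable $f$ is called subgaussian if there is $\sigma\ge 0$ with $\mathbb E\exp(\mathrm{Re}(zf))\le\exp(\sigma^2|z|^2/2)$ for all scalars $z$ (real $z$ if $f$ is real-valued, complex $z$ if $f$ is complex-valued), and $\mathrm{sg}(f)$ denotes the least such $\sigma$. Then there is a constant $C_r>0$, depending only on $s$ if $r=2$ and only on $r,s,M$ if $r>2$, such that for every $K$, all independent (all real or all complex) subgaussian random variables $\gamma_1,\dots,\gamma_K$ on a probability space $(\Omega,\mathcal A,\mathbb P)$ with $\mathrm{sg}(\gamma_j)\le s$ for all $j$ and, if $r>2$, also $\|\gamma_j\|_\infty\le M$ for all $j$, for every finite set $A\subset\mathbb N=\{1,2,\dots\}$ and all Dirichlet polynomials $D_j(w)=\sum_{n\in A}a^{(j)}_n n^{-w}$, $w\in\mathbb C$, $(1\le j\le K)$ with complex coefficients, $$\Big\|\sup_{t\in\mathbb R}\Big|\sum_{j=1}^K\gamma_jD_j(it)\Big|\Big\|_{L_{\varphi_r}}\le C_r\Big(1+\Pi(A)\big(1+20\log\Omega(A)\big)\Big)^{1/r}\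 \sup_{t\in\mathbb R}\big\|(D_j(it))_{j=1}^K\big\|_{S_{r'}}.$$ Here $\varphi_r(t)=e^{t^r}-1$ and $\|f\|_{L_{\varphi_r}}=\inf\{\varepsilon>0:\int\varphi_r(|f|/\varepsilon)\,d\mathbb P\le1\}$; $\|\cdot\|_{S_{2}}$ is the $\ell_2$-norm (case $r=2$) and, for $r>2$, $\|x\|_{S_{r'}}=\|x\|_{\ell_{r',\infty}}=\sup_{k\ge1}k^{1/r'}x_k^*$ with $(x_k^*)$ the decreasing rearrangement of $(|x_j|)$; $\Pi(A)=\max_{n\in A}\pi(n)$ with $\pi(n)$ the number of primes $\le n$, and $\Omega(A)=\max_{n\in A}\Omega(n)$ with $\Omega(n)$ the number of prime divisors of $n$ counted with multiplicity (both maxima are $0$ for $A=\emptyset$, and $0\cdot\log 0$ is read as $0$). -/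

import Mathlib

open MeasureTheory ProbabilityTheory
open scoped ENNReal

noncomputable section

namespace KSZ

/-- The Orlicz norm `‖f‖_{L_φ} = inf {ε > 0 : ∫ φ(|f| / ε) dP ≤ 1}` of a real function,
with values in `[0, ∞]`; it is `∞` when no `ε` is admissible, i.e. when `f` is not in `L_φ`. -/
def orliczNorm {Ω : Type*} [MeasurableSpace Ω] (φ : ℝ → ℝ) (f : Ω → ℝ) (P : Measure Ω) : ℝ≥0∞ :=
  ⨅ (ε : ℝ) (_ : 0 < ε ∧ ∫⁻ ω, ENNReal.ofReal (φ (|f ω| / ε)) ∂P ≤ 1), ENNReal.ofReal ε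

/-- The exponential Orlicz function `φ_r(t) = exp(t ^ r) - 1`. -/
def expOrlicz (r t : ℝ) : ℝ := Real.exp (t ^ r) - 1

/-- `E exp(Re(z f)) ≤ exp(s² |z|² / 2)` for all scalars `z`, where `s ≥ 0`.
For `𝕜 = ℝ` the real part is the identity. -/
def HasSubgaussianBound {𝕜 Ω : Type*} [RCLike 𝕜] [MeasurableSpace Ω] (f : Ω → 𝕜)
    (P : Measure Ω) (s : ℝ) : Prop :=
  0 ≤ s ∧ ∀ z : 𝕜, ∫⁻ ω, ENNReal.ofReal (Real.exp (RCLike.re (z * f ω))) ∂P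
    ≤ ENNReal.ofReal (Real.exp (s ^ 2 * ‖z‖ ^ 2 / 2))

/-- A real or complex random variable is subgaussian if the above bound holds for some `s`. -/
def IsSubgaussian {𝕜 Ω : Type*} [RCLike 𝕜] [MeasurableSpace Ω] (f : Ω → 𝕜)
    (P : Measure Ω) : Prop :=
  ∃ s : ℝ, HasSubgaussianBound f P s

/-- The best subgaussian constant `sg(f)`. -/
def sg {𝕜 Ω : Type*} [RCLike 𝕜] [MeasurableSpace Ω] (f : Ω → 𝕜) (P : Measure Ω) : ℝ :=
  sInf {s : ℝ | HasSubgaussianBound f P s}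

/-- Decreasing rearrangement of a finite family, indexed from `0`: `decRearr x k` is the
`(k + 1)`-st largest of the numbers `‖x i‖`, and `0` if there are at most `k` indices. -/
def decRearr {K : ℕ} (x : Fin K → ℂ) (k : ℕ) : ℝ :=
  sInf {τ : ℝ | 0 ≤ τ ∧ (Finset.univ.filter fun i => τ < ‖x i‖).card ≤ k}

/-- `‖x‖_{ℓ_{p,∞}} = sup_{k ≥ 1} k^{1/p} x*_k`. -/
def marcinkiewiczNorm {K : ℕ} (p : ℝ) (x : Fin K → ℂ) : ℝ :=
  ⨆ k : ℕ, ((k : ℝ) + 1) ^ (1 / p) * decRearr x k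

/-- The norm of `S_{r'}`, where `r' = r / (r - 1)`: `S_{r'}` is `ℓ_2` if `r = 2`,
and `ℓ_{r',∞}` if `r > 2`. -/
def sNorm {K : ℕ} (r : ℝ) (x : Fin K → ℂ) : ℝ :=
  if r = 2 then ‖WithLp.toLp 2 x‖ else marcinkiewiczNorm (r / (r - 1)) x

/-- The Dirichlet polynomials `s ↦ ∑_{n ∈ A} a_n n^{-s}` with frequencies in `A`. -/
def dirichletPolynomials (A : Finset ℕ) : Set (ℂ → ℂ) :=
  {D | ∃ a : ℕ → ℂ, ∀ s : ℂ, D s = ∑ n ∈ A, a n * (n : ℂ) ^ (-s)}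

/-- `Π(A) = max_{n ∈ A} π(n)`. -/
def maxPrimeCount (A : Finset ℕ) : ℕ := A.sup Nat.primeCounting

/-- `Ω(A) = max_{n ∈ A} Ω(n)`, prime divisors being counted with multiplicity. -/
def maxPrimeFactors (A : Finset ℕ) : ℕ := A.sup fun n => ArithmeticFunction.cardFactors n

/-- `ω ↦ sup_{t ∈ ℝ} |∑_j γ_j(ω) D_j(it)|`. For Dirichlet polynomials `D_j` the supremum is over
a bounded set. `RCLike.map 𝕜 ℂ` is the inclusion of the scalar field into `ℂ`. -/
def randomSup {𝕜 Ω : Type*} [RCLike 𝕜] {K : ℕ} (γ : Fin K → Ω → 𝕜) (D : Fin K → ℂ → ℂ)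
    (ω : Ω) : ℝ :=
  ⨆ t : ℝ, ‖∑ j, RCLike.map 𝕜 ℂ (γ j ω) * D j (t * Complex.I)‖

/-- The right-hand side without the constant:
`(1 + Π(A) (1 + 20 log Ω(A)))^{1/r} sup_{t ∈ ℝ} ‖(D_j(it))_j‖_{S_{r'}}`.
If `Ω(A) = 0`, then `Π(A) = 0` and the first factor is `1`. -/
def kszBound {K : ℕ} (r : ℝ) (A : Finset ℕ) (D : Fin K → ℂ → ℂ) : ℝ :=
  (1 + (maxPrimeCount A : ℝ) * (1 + 20 * Real.log (maxPrimeFactors A))) ^ (1 / r) *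
    ⨆ t : ℝ, sNorm r fun j => D j (t * Complex.I)

end KSZ

end

/-! The proof uses high moments. Put Λ = 1 + Π(A)(1 + 20 log Ω(A)) and F = ∑ γ_j D_j. The power F^k
is a Dirichlet polynomial with frequencies in the product set A^k. Almost orthogonality of the
functions n^{-it} over a long arithmetic progression of points t bounds sup |F(it)|^{2k} by 2|A^k|
times a mean of |F|^{2k} over finitely many points (`exists_sampling_pow`). Rankin's trick shows
that 2|A^k| ≤ e^{4k} once k ≥ Λ (`two_mul_card_pow_le`), so after taking 2k-th roots the supremum
costs only a factor e².

The sample points depend on A and k but not on the coefficients, hence not on ω. Integration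
therefore reduces everything to the moments of ∑ γ_j x_j for a fixed vector x, whose 2k-th roots are
at most C k^{1/r} ‖x‖ (`hasMomentBound_two`, `hasMomentBound_of_bounded`).

This controls the supremum only for moments with k ≥ Λ. In the Taylor series of exp each term is
dominated by a moment whose k is a multiple of ⌈Λ⌉, and the loss is exactly the factor Λ^{1/r}
(`orliczNorm_expOrlicz_le`). -/

noncomputable section

namespace KSZ

/-! ### Product sets of frequencies and their cardinality. -/

open scoped Pointwise in
/-- Powers of a Dirichlet polynomial with frequencies in `A` are Dirichlet polynomials with
frequencies in the `k`-fold product set `A ^ k`. -/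
lemma exists_pow_dirichlet (A : Finset ℕ) (a : ℕ → ℂ) (k : ℕ) :
    ∃ c : ℕ → ℂ, ∀ w : ℂ, (∑ n ∈ A, a n * (n : ℂ) ^ (-w)) ^ k =
      ∑ n ∈ A ^ k, c n * (n : ℂ) ^ (-w) := by
  induction k with
  | zero => exact ⟨fun _ => 1, fun w => by
      rw [pow_zero, pow_zero, ← Finset.singleton_one, Finset.sum_singleton]; simp⟩
  | succ k ih =>
    obtain ⟨c, hc⟩ := ih
    refine ⟨fun n => ∑ p ∈ ((A ^ k) ×ˢ A : Finset (ℕ × ℕ)) with p.1 * p.2 = n, c p.1 * a p.2, fun w => ?_⟩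
    rw [pow_succ, hc, Finset.sum_mul_sum, ← Finset.sum_product', pow_succ]
    have hmaps : ∀ p ∈ ((A ^ k) ×ˢ A : Finset (ℕ × ℕ)), p.1 * p.2 ∈ A ^ k * A := fun p hp => by
      rw [Finset.mem_product] at hp
      exact Finset.mul_mem_mul hp.1 hp.2
    rw [← Finset.sum_fiberwise_of_maps_to hmaps]
    refine Finset.sum_congr rfl fun n _ => ?_
    rw [Finset.sum_mul]
    refine Finset.sum_congr rfl fun p hp => ?_
    rw [← (Finset.mem_filter.1 hp).2, Nat.cast_mul, Complex.natCast_mul_natCast_cpow]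
    ring

/-- The completely multiplicative function `n ↦ y ^ Ω(n)`. -/
def powCardFactors (y : ℝ) : ℕ →*₀ ℝ where
  toFun n := if n = 0 then 0 else y ^ ArithmeticFunction.cardFactors n
  map_zero' := by simp
  map_one' := by simp
  map_mul' m n := by
    by_cases hm : m = 0
    · simp [hm]
    by_cases hn : n = 0
    · simp [hn]
    simp [hm, hn, ArithmeticFunction.cardFactors_mul hm hn, pow_add]

/-- Rankin's bound for the number of smooth numbers with few prime factors. -/
lemma card_mul_pow_le_of_smooth {y : ℝ} (hy0 : 0 < y) (hy1 : y < 1) (S : Finset ℕ) (Q d : ℕ)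
    (hS : ∀ n ∈ S, n ∈ Nat.smoothNumbers (Q + 1))
    (hd : ∀ n ∈ S, ArithmeticFunction.cardFactors n ≤ d) :
    (S.card : ℝ) * y ^ d ≤ (1 - y)⁻¹ ^ Nat.primeCounting Q := by
  have hp : ∀ {p : ℕ}, p.Prime → powCardFactors y p = y := fun {p} hp => by
    simp [powCardFactors, hp.ne_zero, ArithmeticFunction.cardFactors_apply_prime hp]
  -- The Euler product evaluates the sum of y^Ω(n) over all n whose prime factors are at most Q.
  -- Each n in S contributes at least y^d to it.
  obtain ⟨-, hsum⟩ := EulerProduct.summable_and_hasSum_smoothNumbers_prod_primesBelow_geometric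
    (f := (powCardFactors y : ℕ →* ℝ))
    (fun {p} hpr => by
      change ‖powCardFactors y p‖ < 1
      rw [hp hpr, Real.norm_of_nonneg hy0.le]; exact hy1) (Q + 1)
  have hprod : ∏ p ∈ (Q + 1).primesBelow, (1 - (powCardFactors y : ℕ →* ℝ) p)⁻¹
      = (1 - y)⁻¹ ^ Nat.primeCounting Q := by
    rw [Finset.prod_congr rfl (g := fun _ => (1 - y)⁻¹), Finset.prod_const,
      Nat.primesBelow_card_eq_primeCounting', Nat.primeCounting_eq_primeCounting'_succ]
    intro p hpm
    change (1 - powCardFactors y p)⁻¹ = _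
    rw [hp (Nat.prime_of_mem_primesBelow hpm)]
  rw [hprod] at hsum
  have hle := sum_le_hasSum (S.subtype (· ∈ Nat.smoothNumbers (Q + 1))) (fun n _ => by
    change 0 ≤ powCardFactors y n
    simp only [powCardFactors, MonoidWithZeroHom.coe_mk, ZeroHom.coe_mk]
    split_ifs <;> positivity) hsum
  refine le_trans ?_ hle
  have hcard : (S.subtype (· ∈ Nat.smoothNumbers (Q + 1))).card = S.card := by
    rw [Finset.card_subtype, Finset.filter_true_of_mem hS]
  rw [← hcard, ← nsmul_eq_mul]
  refine Finset.card_nsmul_le_sum _ _ _ fun n hn => ?_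
  have hnS := Finset.mem_subtype.1 hn
  change y ^ d ≤ powCardFactors y n
  simp only [powCardFactors, MonoidWithZeroHom.coe_mk, ZeroHom.coe_mk,
    if_neg (Nat.ne_zero_of_mem_smoothNumbers n.2)]
  exact pow_le_pow_of_le_one hy0.le hy1.le (hd n hnS)

open scoped Pointwise in
lemma mem_pow_smooth (A : Finset ℕ) (hA : ∀ n ∈ A, 0 < n) (k : ℕ) :
    ∀ n ∈ A ^ k, n ∈ Nat.smoothNumbers (A.sup id + 1) ∧
      ArithmeticFunction.cardFactors n ≤ k * maxPrimeFactors A := by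
  induction k with
  | zero =>
    intro n hn
    rw [pow_zero, Finset.mem_one] at hn
    subst hn
    exact ⟨Nat.mem_smoothNumbers.2 (by simp), by simp⟩
  | succ k ih =>
    intro n hn
    rw [pow_succ, Finset.mem_mul] at hn
    obtain ⟨u, hu, v, hv, rfl⟩ := hn
    obtain ⟨h1, h2⟩ := ih u hu
    refine ⟨Nat.mul_mem_smoothNumbers h1 (Nat.mem_smoothNumbers_of_lt (hA v hv)
      (Nat.lt_succ_of_le (Finset.le_sup (f := id) hv))), ?_⟩
    rw [ArithmeticFunction.cardFactors_mul (Nat.ne_zero_of_mem_smoothNumbers h1) (hA v hv).ne',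
      add_one_mul]
    exact add_le_add h2 (Finset.le_sup (f := fun n => ArithmeticFunction.cardFactors n) hv)

lemma primeCounting_sup_le (A : Finset ℕ) :
    Nat.primeCounting (A.sup id) ≤ maxPrimeCount A := by
  rcases A.eq_empty_or_nonempty with rfl | hne
  · simp
  · obtain ⟨n, hn, h⟩ := Finset.exists_mem_eq_sup A hne id
    rw [h]
    exact Finset.le_sup (f := Nat.primeCounting) hn

/-- For m ≥ 1 use m + 2 ≤ 3m. At m = 0 the default value `Real.log 0 = 0` is harmless, since log 2 ≤
2. -/
lemma log_add_two_le (m : ℕ) : Real.log ((m : ℝ) + 2) ≤ 2 * (1 + 20 * Real.log m) := by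
  rcases Nat.eq_zero_or_pos m with rfl | hm
  · have := Real.log_two_lt_d9
    norm_num; linarith
  · have hm' : (1 : ℝ) ≤ m := by exact_mod_cast hm
    have h0 := Real.log_nonneg hm'
    have h3 : Real.log 3 ≤ 2 := by
      have := Real.log_le_sub_one_of_pos (show (0 : ℝ) < 3 by norm_num)
      linarith
    have : Real.log ((m : ℝ) + 2) ≤ Real.log (3 * m) :=
      Real.log_le_log (by positivity) (by linarith)
    rw [Real.log_mul (by norm_num) (by positivity)] at this
    linarith

open scoped Pointwise in
/-- The cardinality of `A ^ k` grows at most exponentially as soon as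
`k ≥ 1 + Π(A) (1 + 20 log Ω(A))`. -/
lemma two_mul_card_pow_le (A : Finset ℕ) (hA : ∀ n ∈ A, 0 < n) (k : ℕ)
    (hk : 1 + (maxPrimeCount A : ℝ) * (1 + 20 * Real.log (maxPrimeFactors A)) ≤ k) :
    2 * ((A ^ k).card : ℝ) ≤ Real.exp 2 ^ (2 * k) := by
  set m := maxPrimeFactors A
  set N := maxPrimeCount A
  have hm0 : (0 : ℝ) ≤ m := m.cast_nonneg
  have hlog0 : 0 ≤ Real.log m := Real.log_natCast_nonneg m
  -- This weight balances Rankin's bound: each Euler factor is (1 - y)⁻¹ = m + 2, while y^(km) ≥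
  -- e^{-k}, so removing the weight costs only e^k.
  set y : ℝ := (m + 1) / (m + 2) with hy
  have hy0 : 0 < y := by positivity
  have hy1 : y < 1 := by rw [hy, div_lt_one (by positivity)]; linarith
  have h1y : (1 - y)⁻¹ = m + 2 := by rw [hy]; field_simp; ring
  have hrank := card_mul_pow_le_of_smooth hy0 hy1 (A ^ k) (A.sup id) (k * m)
    (fun n hn => (mem_pow_smooth A hA k n hn).1) (fun n hn => (mem_pow_smooth A hA k n hn).2)
  rw [h1y] at hrank
  have hyk : Real.exp (-k) ≤ y ^ (k * m) := by
    have h1 : Real.exp (-(1 / (m + 1 : ℝ))) ≤ y := by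
      rw [Real.exp_neg, inv_le_comm₀ (Real.exp_pos _) hy0]
      calc y⁻¹ = 1 / (m + 1 : ℝ) + 1 := by rw [hy]; field_simp; ring
        _ ≤ _ := Real.add_one_le_exp _
    calc Real.exp (-k) ≤ Real.exp ((k * m : ℕ) * (-(1 / (m + 1 : ℝ)))) := by
          refine Real.exp_le_exp.2 ?_
          have : (k : ℝ) * (m / (m + 1)) ≤ k * 1 :=
            mul_le_mul_of_nonneg_left ((div_le_one (by positivity)).2 (by linarith)) k.cast_nonneg
          calc -(k : ℝ) ≤ -(k * (m / (m + 1))) := by linarith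
            _ = _ := by push_cast; ring
      _ = Real.exp (-(1 / (m + 1 : ℝ))) ^ (k * m) := Real.exp_nat_mul _ _
      _ ≤ _ := pow_le_pow_left₀ (Real.exp_pos _).le h1 _
  -- The summand 1 in the hypothesis on k yields the -2 in the exponent, which later absorbs the
  -- factor 2 in front of the cardinality.
  have hN : ((m : ℝ) + 2) ^ Nat.primeCounting (A.sup id) ≤ Real.exp (2 * k - 2) := by
    calc ((m : ℝ) + 2) ^ Nat.primeCounting (A.sup id) ≤ ((m : ℝ) + 2) ^ N :=
          pow_le_pow_right₀ (by linarith) (primeCounting_sup_le A)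
      _ = Real.exp (N * Real.log (m + 2)) := by
          rw [Real.exp_nat_mul, Real.exp_log (by positivity)]
      _ ≤ _ := by
          refine Real.exp_le_exp.2 ?_
          have := mul_le_mul_of_nonneg_left (log_add_two_le m) (Nat.cast_nonneg (α := ℝ) N)
          linarith
  have h2 : (2 : ℝ) ≤ Real.exp 2 := by linarith [Real.add_one_le_exp (2 : ℝ)]
  have h3 : ((A ^ k).card : ℝ) * Real.exp (-k) ≤ Real.exp (2 * k - 2) :=
    (mul_le_mul_of_nonneg_left hyk (Nat.cast_nonneg _)).trans (hrank.trans hN)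
  have h4 : ((A ^ k).card : ℝ) ≤ Real.exp (3 * k - 2) := by
    calc ((A ^ k).card : ℝ) = ((A ^ k).card : ℝ) * Real.exp (-k) * Real.exp k := by
          rw [mul_assoc, ← Real.exp_add]; simp
      _ ≤ Real.exp (2 * k - 2) * Real.exp k := by gcongr
      _ = _ := by rw [← Real.exp_add]; ring_nf
  calc 2 * ((A ^ k).card : ℝ) ≤ Real.exp 2 * Real.exp (3 * k - 2) := by gcongr
    _ = Real.exp (3 * k) := by rw [← Real.exp_add]; ring_nf
    _ ≤ Real.exp ((2 * k : ℕ) * 2) := by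
        refine Real.exp_le_exp.2 ?_
        push_cast
        have : (0 : ℝ) ≤ k := k.cast_nonneg
        linarith
    _ = _ := Real.exp_nat_mul _ _

/-! ### Sampling of exponential sums at finitely many points. -/

open Filter Topology ComplexConjugate in
lemma tendsto_average_pow {ω : ℂ} (h1 : ‖ω‖ = 1) (hne : ω ≠ 1) :
    Tendsto (fun L : ℕ => (1 / (L : ℂ)) * ∑ l ∈ Finset.range L, ω ^ l) atTop (𝓝 0) := by
  refine squeeze_zero_norm (a := fun L : ℕ => (2 / ‖ω - 1‖) / (L : ℝ)) (fun L => ?_)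
    (tendsto_const_div_atTop_nhds_zero_nat _)
  rw [geom_sum_eq hne, norm_mul, norm_div, norm_div, norm_one, Complex.norm_natCast]
  have : ‖ω ^ L - 1‖ ≤ 2 := by
    calc ‖ω ^ L - 1‖ ≤ ‖ω ^ L‖ + ‖(1 : ℂ)‖ := norm_sub_le _ _
      _ = 2 := by rw [norm_pow, h1]; norm_num
  calc 1 / (L : ℝ) * (‖ω ^ L - 1‖ / ‖ω - 1‖) ≤ 1 / (L : ℝ) * (2 / ‖ω - 1‖) := by gcongr
    _ = _ := by ring

open Filter Topology ComplexConjugate in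
/-- Finite averages of exponential sums with distinct frequencies control the coefficients. -/
lemma exists_average_sq_ge (S : Finset ℕ) (z : ℕ → ℂ) (hz : ∀ n ∈ S, ‖z n‖ = 1)
    (hinj : Set.InjOn z S) :
    ∃ L : ℕ, 0 < L ∧ ∀ a : ℕ → ℂ, ∑ n ∈ S, ‖a n‖ ^ 2 ≤
      2 * ((1 / (L : ℝ)) * ∑ l ∈ Finset.range L, ‖∑ n ∈ S, a n * z n ^ l‖ ^ 2) := by
  -- With this tolerance, the off-diagonal terms are at most half of the diagonal ones, by
  -- Cauchy–Schwarz.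
  set δ : ℝ := 1 / (2 * (S.card + 1)) with hδ
  have hδ0 : 0 < δ := by positivity
  set E : ℕ → ℕ → ℕ → ℂ := fun L n m =>
    (1 / (L : ℂ)) * ∑ l ∈ Finset.range L, (z n * conj (z m)) ^ l with hE
  have hmul : ∀ n ∈ S, z n * conj (z n) = 1 := fun n hn => by
    rw [Complex.mul_conj, Complex.normSq_eq_norm_sq, hz n hn]; simp
  have hev : ∀ᶠ L in atTop, ∀ n ∈ S, ∀ m ∈ S, n ≠ m → ‖E L n m‖ ≤ δ := by
    refine (S.eventually_all).2 fun n hn => (S.eventually_all).2 fun m hm => ?_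
    by_cases hnm : n = m
    · simp [hnm]
    · have hne : z n * conj (z m) ≠ 1 := fun h => hnm <| hinj hn hm <| by
        calc z n = z n * (z m * conj (z m)) := by rw [hmul m hm, mul_one]
          _ = z n * conj (z m) * z m := by ring
          _ = z m := by rw [h, one_mul]
      have ht := tendsto_average_pow (ω := z n * conj (z m))
        (by rw [norm_mul, RCLike.norm_conj, hz n hn, hz m hm, one_mul]) hne
      filter_upwards [ht.norm.eventually (ge_mem_nhds (by simpa using hδ0))] with L hL _
      exact hL
  obtain ⟨L, hL, hL0⟩ := (hev.and (eventually_gt_atTop 0)).exists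
  have hLC : (L : ℂ) ≠ 0 := by exact_mod_cast hL0.ne'
  refine ⟨L, hL0, fun a => ?_⟩
  -- The deviation of the averaged Gram matrix of the sequences l ↦ z n ^ l from the identity.
  set e : ℕ → ℕ → ℂ := fun n m => E L n m - if n = m then 1 else 0 with he
  have hebound : ∀ n ∈ S, ∀ m ∈ S, ‖e n m‖ ≤ δ := fun n hn m hm => by
    by_cases hnm : n = m
    · subst hnm
      have : e n n = 0 := by
        simp only [he, hE, hmul n hn, one_pow, Finset.sum_const, Finset.card_range, if_true,
          nsmul_eq_mul, mul_one]
        field_simp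
        ring
      rw [this, norm_zero]; exact hδ0.le
    · simp only [he, if_neg hnm, sub_zero]
      exact hL n hn m hm hnm
  have hexp : (((1 / (L : ℝ)) * ∑ l ∈ Finset.range L, ‖∑ n ∈ S, a n * z n ^ l‖ ^ 2 : ℝ) : ℂ)
      = ∑ n ∈ S, ∑ m ∈ S, a n * conj (a m) * E L n m := by
    push_cast
    have h1 : ∀ l, ((‖∑ n ∈ S, a n * z n ^ l‖ : ℂ)) ^ 2
        = ∑ n ∈ S, ∑ m ∈ S, a n * conj (a m) * (z n * conj (z m)) ^ l := fun l => by
      rw [← Complex.mul_conj', map_sum, Finset.sum_mul_sum]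
      refine Finset.sum_congr rfl fun n _ => Finset.sum_congr rfl fun m _ => ?_
      rw [map_mul, map_pow, mul_pow]
      ring
    simp_rw [h1, hE, Finset.mul_sum]
    rw [Finset.sum_comm]
    refine Finset.sum_congr rfl fun n _ => ?_
    rw [Finset.sum_comm]
    refine Finset.sum_congr rfl fun m _ => Finset.sum_congr rfl fun l _ => ?_
    ring
  have hsplit : ∑ n ∈ S, ∑ m ∈ S, a n * conj (a m) * E L n m
      = ((∑ n ∈ S, ‖a n‖ ^ 2 : ℝ) : ℂ) + ∑ n ∈ S, ∑ m ∈ S, a n * conj (a m) * e n m := by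
    push_cast
    rw [← Finset.sum_add_distrib]
    refine Finset.sum_congr rfl fun n hn => ?_
    have h2 : ∑ m ∈ S, a n * conj (a m) * (if n = m then (1 : ℂ) else 0) = (‖a n‖ : ℂ) ^ 2 := by
      simp only [mul_ite, mul_one, mul_zero, Finset.sum_ite_eq, if_pos hn]
      exact Complex.mul_conj' _
    rw [← h2, ← Finset.sum_add_distrib]
    refine Finset.sum_congr rfl fun m _ => ?_
    simp only [he]; ring
  have herr : ‖∑ n ∈ S, ∑ m ∈ S, a n * conj (a m) * e n m‖ ≤ δ * (∑ n ∈ S, ‖a n‖) ^ 2 := by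
    calc _ ≤ ∑ n ∈ S, ∑ m ∈ S, ‖a n‖ * ‖a m‖ * δ := by
          refine norm_sum_le_of_le _ fun n hn => norm_sum_le_of_le _ fun m hm => ?_
          rw [norm_mul, norm_mul, RCLike.norm_conj]
          exact mul_le_mul_of_nonneg_left (hebound n hn m hm) (by positivity)
      _ = _ := by rw [sq, Finset.sum_mul_sum, Finset.mul_sum]; simp_rw [Finset.mul_sum]; simp only [mul_comm δ]
  have hCS : (∑ n ∈ S, ‖a n‖) ^ 2 ≤ S.card * ∑ n ∈ S, ‖a n‖ ^ 2 := sq_sum_le_card_mul_sum_sq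
  have hsum0 : 0 ≤ ∑ n ∈ S, ‖a n‖ ^ 2 := by positivity
  have hδS : δ * S.card ≤ 1 / 2 := by
    rw [hδ, div_mul_eq_mul_div, one_mul, div_le_div_iff₀ (by positivity) (by norm_num)]
    linarith
  set W := (1 / (L : ℝ)) * ∑ l ∈ Finset.range L, ‖∑ n ∈ S, a n * z n ^ l‖ ^ 2
  have hfin : ‖((W - ∑ n ∈ S, ‖a n‖ ^ 2 : ℝ) : ℂ)‖ ≤ 1 / 2 * ∑ n ∈ S, ‖a n‖ ^ 2 := by
    rw [Complex.ofReal_sub, hexp, hsplit, add_sub_cancel_left]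
    calc _ ≤ δ * (S.card * ∑ n ∈ S, ‖a n‖ ^ 2) := herr.trans (by gcongr)
      _ = δ * S.card * ∑ n ∈ S, ‖a n‖ ^ 2 := by ring
      _ ≤ _ := by gcongr
  rw [Complex.norm_real, Real.norm_eq_abs] at hfin
  linarith [(abs_le.1 hfin).1]

/-- A Dirichlet polynomial on the imaginary axis is controlled by its quadratic mean over a finite
set of points that depends only on the frequencies. -/
lemma exists_sampling (S : Finset ℕ) (hS : ∀ n ∈ S, 0 < n) :
    ∃ (L : ℕ) (τ : ℕ → ℝ), 0 < L ∧ ∀ (a : ℕ → ℂ) (t : ℝ),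
      ‖∑ n ∈ S, a n * (n : ℂ) ^ (-(t * Complex.I))‖ ^ 2 ≤ 2 * S.card *
        ((1 / (L : ℝ)) *
          ∑ l ∈ Finset.range L, ‖∑ n ∈ S, a n * (n : ℂ) ^ (-(τ l * Complex.I))‖ ^ 2) := by
  -- The step is so small that θ log n lies in [0, 1] for n in S. Hence n ↦ n^{-iθ} is injective on
  -- S, and the values at the points lθ are powers of these unimodular numbers.
  set θ : ℝ := 1 / (1 + Real.log (S.sup id : ℕ)) with hθ
  have hlog : 0 ≤ Real.log (S.sup id : ℕ) := Real.log_natCast_nonneg _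
  have hθ0 : 0 < θ := by positivity
  have hnorm : ∀ n ∈ S, ∀ t : ℝ, ‖(n : ℂ) ^ (-(t * Complex.I))‖ = 1 := fun n hn t => by
    rw [Complex.norm_natCast_cpow_of_pos (hS n hn)]; simp
  have hexp : ∀ n ∈ S, (n : ℂ) ^ (-(θ * Complex.I))
      = Complex.exp ((-(θ * Real.log n) : ℝ) * Complex.I) := fun n hn => by
    rw [Complex.cpow_def_of_ne_zero (by exact_mod_cast (hS n hn).ne'), ← Complex.natCast_log]
    congr 1; push_cast; ring
  have hrange : ∀ n ∈ S, 0 ≤ θ * Real.log n ∧ θ * Real.log n ≤ 1 := fun n hn => by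
    have h1 : (0 : ℝ) < n := by exact_mod_cast hS n hn
    have h2 : Real.log n ≤ Real.log (S.sup id : ℕ) :=
      Real.log_le_log h1 (by exact_mod_cast Finset.le_sup (f := id) hn)
    refine ⟨mul_nonneg hθ0.le (Real.log_natCast_nonneg n), ?_⟩
    rw [hθ, div_mul_eq_mul_div, one_mul, div_le_one (by positivity)]
    linarith
  obtain ⟨L, hL, hle⟩ := exists_average_sq_ge S (fun n => (n : ℂ) ^ (-(θ * Complex.I)))
    (fun n hn => hnorm n hn θ) (fun n hn m hm h => by
      have hn' := hrange n hn
      have hm' := hrange m hm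
      have hpi := Real.pi_gt_three
      simp only [hexp n hn, hexp m hm] at h
      have h := Complex.exp_inj_of_neg_pi_lt_of_le_pi
        (by simp only [Complex.mul_im, Complex.ofReal_re, Complex.I_im, Complex.ofReal_im, Complex.I_re]; linarith)
        (by simp only [Complex.mul_im, Complex.ofReal_re, Complex.I_im, Complex.ofReal_im, Complex.I_re]; linarith)
        (by simp only [Complex.mul_im, Complex.ofReal_re, Complex.I_im, Complex.ofReal_im, Complex.I_re]; linarith)
        (by simp only [Complex.mul_im, Complex.ofReal_re, Complex.I_im, Complex.ofReal_im, Complex.I_re]; linarith) h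
      have h := Complex.ofReal_injective (mul_right_cancel₀ Complex.I_ne_zero h)
      have h := mul_left_cancel₀ hθ0.ne' (neg_injective h)
      exact_mod_cast Real.log_injOn_pos (Set.mem_Ioi.2 (by exact_mod_cast hS n hn))
        (Set.mem_Ioi.2 (by exact_mod_cast hS m hm)) h)
  refine ⟨L, fun l => l * θ, hL, fun a t => ?_⟩
  have hpow : ∀ l : ℕ, ∑ n ∈ S, a n * ((n : ℂ) ^ (-(θ * Complex.I))) ^ l
      = ∑ n ∈ S, a n * (n : ℂ) ^ (-(((l * θ : ℝ) : ℂ) * Complex.I)) := fun l =>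
    Finset.sum_congr rfl fun n _ => by
      rw [← Complex.cpow_nat_mul]; congr 2; push_cast; ring
  have h := hle a
  simp only [hpow] at h
  calc _ ≤ (∑ n ∈ S, ‖a n‖) ^ 2 := by
        gcongr
        refine norm_sum_le_of_le _ fun n hn => ?_
        rw [norm_mul, hnorm n hn, mul_one]
    _ ≤ S.card * ∑ n ∈ S, ‖a n‖ ^ 2 := sq_sum_le_card_mul_sum_sq
    _ ≤ S.card * (2 * _) := by gcongr
    _ = _ := by ring

/-! ### From moments to the exponential Orlicz norm. -/

/-- Moment growth of order `k ^ (1 / r)` yields a bound for the exponential Orlicz norm. -/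
lemma orliczNorm_expOrlicz_le {Ω : Type*} [MeasurableSpace Ω] {P : Measure Ω}
    [IsProbabilityMeasure P] {X : Ω → ℝ} (hX : ∀ ω, 0 ≤ X ω) {r R : ℝ} (hr : 1 ≤ r) (hR : 0 < R)
    {κ : ℕ} (hκ : 0 < κ)
    (h : ∀ k : ℕ, κ ≤ k → ∃ V : Ω → ℝ≥0∞, AEMeasurable V P ∧ ∫⁻ ω, V ω ∂P ≤ 1 ∧
      ∀ ω, ENNReal.ofReal ((X ω / (R * (k : ℝ) ^ (1 / r))) ^ (2 * k)) ≤ V ω) :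
    orliczNorm (expOrlicz r) X P ≤ ENNReal.ofReal (R * (9 * ⌈r⌉₊ * κ) ^ (1 / r)) := by
  have hr0 : 0 < r := by linarith
  have hρ : 0 < ⌈r⌉₊ := Nat.ceil_pos.2 hr0
  have hρ' : (0 : ℝ) < ⌈r⌉₊ := by exact_mod_cast hρ
  have hκ' : (0 : ℝ) < κ := by exact_mod_cast hκ
  -- Measurable majorants V are integrated instead of X, so that no measurability of X is required.
  choose! V hVm hV1 hVX using h
  -- For the Taylor term of order p + 1 this k is admissible (k ≥ κ), and 2k ≥ r(p + 1), so the
  -- 2k-th moment dominates the required power.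
  set k : ℕ → ℕ := fun p => κ * (⌈r⌉₊ * (p + 1)) with hk
  have hκk : ∀ p, κ ≤ k p := fun p => Nat.le_mul_of_pos_right _ (by positivity)
  have hε : 0 < R * (9 * ⌈r⌉₊ * κ : ℝ) ^ (1 / r) := by positivity
  have hterm : ∀ ω p, ENNReal.ofReal
      (((|X ω| / (R * (9 * ⌈r⌉₊ * κ : ℝ) ^ (1 / r))) ^ r) ^ (p + 1) / (p + 1).factorial)
      ≤ ENNReal.ofReal ((1 / 3) ^ (p + 1)) * (1 + V (k p) ω) := fun ω p => by
    set Y := X ω / (R * (k p : ℝ) ^ (1 / r)) with hY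
    have hY0 : 0 ≤ Y := div_nonneg (hX ω) (by positivity)
    have hp0 : (0 : ℝ) < p + 1 := by positivity
    -- The constant 9 serves here: by n^n / n! ≤ e^n ≤ 3^n the Taylor coefficients become at most
    -- 3^{-(p+1)}, and the sum of 2 · 3^{-(p+1)} is exactly 1.
    have hu : (|X ω| / (R * (9 * ⌈r⌉₊ * κ : ℝ) ^ (1 / r))) ^ r = Y ^ r * ((p + 1) / 9) := by
      have h1 : |X ω| / (R * (9 * ⌈r⌉₊ * κ : ℝ) ^ (1 / r)) = Y * ((p + 1) / 9 : ℝ) ^ (1 / r) := by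
        have hkp : (k p : ℝ) = (9 * ⌈r⌉₊ * κ) * ((p + 1) / 9) := by
          simp only [hk]; push_cast; ring
        rw [abs_of_nonneg (hX ω), hY, hkp]
        have hc : (0 : ℝ) < 9 * ⌈r⌉₊ * κ := by positivity
        generalize (9 * ⌈r⌉₊ * κ : ℝ) = c at hc
        rw [Real.mul_rpow hc.le (by positivity)]
        have h2 : ((p + 1) / 9 : ℝ) ^ (1 / r) ≠ 0 := by positivity
        have h3 : c ^ (1 / r) ≠ 0 := by positivity
        generalize ((p + 1) / 9 : ℝ) ^ (1 / r) = d at *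
        generalize c ^ (1 / r) = e at *
        field_simp
      rw [h1, Real.mul_rpow hY0 (by positivity), ← Real.rpow_mul (by positivity),
        one_div_mul_cancel hr0.ne', Real.rpow_one]
    have hYr : (Y ^ r) ^ (p + 1) ≤ 1 + Y ^ (2 * k p) := by
      rcases le_total Y 1 with h1 | h1
      · have : (Y ^ r) ^ (p + 1) ≤ 1 := pow_le_one₀ (by positivity)
          (Real.rpow_le_one hY0 h1 hr0.le)
        have : 0 ≤ Y ^ (2 * k p) := by positivity
        linarith
      · have : (Y ^ r) ^ (p + 1) ≤ (Y ^ ⌈r⌉₊) ^ (p + 1) := by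
          gcongr
          rw [← Real.rpow_natCast]
          exact Real.rpow_le_rpow_of_exponent_le h1 (Nat.le_ceil r)
        have h2 : (Y ^ ⌈r⌉₊) ^ (p + 1) ≤ Y ^ (2 * k p) := by
          rw [← pow_mul]
          refine pow_le_pow_right₀ h1 ?_
          calc ⌈r⌉₊ * (p + 1) ≤ κ * (⌈r⌉₊ * (p + 1)) := Nat.le_mul_of_pos_left _ hκ
            _ ≤ 2 * k p := by simp only [hk]; omega
        linarith
    have hfac : ((p + 1 : ℝ) / 9) ^ (p + 1) / (p + 1).factorial ≤ (1 / 3) ^ (p + 1) := by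
      have h1 := Real.pow_div_factorial_le_exp ((p + 1 : ℕ) : ℝ) (by positivity) (p + 1)
      have h2 : Real.exp (p + 1 : ℕ) ≤ 3 ^ (p + 1) := by
        rw [← mul_one ((p + 1 : ℕ) : ℝ), Real.exp_nat_mul]
        have := Real.exp_one_lt_d9
        gcongr; linarith
      push_cast at h1 h2
      calc ((p + 1 : ℝ) / 9) ^ (p + 1) / (p + 1).factorial
          = ((p + 1 : ℝ) ^ (p + 1) / (p + 1).factorial) * (1 / 9) ^ (p + 1) := by
            rw [div_pow, div_pow, one_pow]; ring
        _ ≤ 3 ^ (p + 1) * (1 / 9) ^ (p + 1) := by gcongr; exact h1.trans h2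
        _ = _ := by rw [← mul_pow]; norm_num
    calc _ ≤ ENNReal.ofReal ((1 / 3) ^ (p + 1) * (1 + Y ^ (2 * k p))) := by
          refine ENNReal.ofReal_le_ofReal ?_
          rw [hu, mul_pow, mul_div_assoc, mul_comm]
          gcongr
      _ = ENNReal.ofReal ((1 / 3) ^ (p + 1)) * (1 + ENNReal.ofReal (Y ^ (2 * k p))) := by
          rw [ENNReal.ofReal_mul (by positivity), ENNReal.ofReal_add zero_le_one (by positivity),
            ENNReal.ofReal_one]
      _ ≤ _ := by gcongr; exact hVX _ (hκk p) ω
  refine iInf₂_le_of_le _ ⟨hε, ?_⟩ le_rfl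
  have hpt : ∀ ω, ENNReal.ofReal (expOrlicz r (|X ω| / (R * (9 * ⌈r⌉₊ * κ : ℝ) ^ (1 / r))))
      ≤ ∑' p : ℕ, ENNReal.ofReal ((1 / 3) ^ (p + 1)) * (1 + V (k p) ω) := fun ω => by
    refine le_trans ?_ (ENNReal.tsum_le_tsum (hterm ω))
    set u := (|X ω| / (R * (9 * ⌈r⌉₊ * κ : ℝ) ^ (1 / r))) ^ r
    have hu0 : 0 ≤ u := by positivity
    have hs : HasSum (fun p : ℕ => u ^ (p + 1) / (p + 1).factorial) (Real.exp u - 1) := by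
      have h := NormedSpace.expSeries_div_hasSum_exp u
      rw [← Real.exp_eq_exp_ℝ] at h
      simpa using (hasSum_nat_add_iff' 1).2 h
    rw [← ENNReal.ofReal_tsum_of_nonneg (fun p => by positivity) hs.summable, hs.tsum_eq]
    rfl
  calc _ ≤ ∫⁻ ω, ∑' p : ℕ, ENNReal.ofReal ((1 / 3) ^ (p + 1)) * (1 + V (k p) ω) ∂P :=
        lintegral_mono hpt
    _ = ∑' p : ℕ, ENNReal.ofReal ((1 / 3) ^ (p + 1)) * ∫⁻ ω, (1 + V (k p) ω) ∂P := by
        rw [lintegral_tsum fun p => ((hVm _ (hκk p)).const_add 1).const_mul _]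
        simp_rw [fun p => lintegral_const_mul'' (ENNReal.ofReal ((1 / 3) ^ (p + 1)))
          ((hVm _ (hκk p)).const_add 1)]
    _ ≤ ∑' p : ℕ, ENNReal.ofReal ((1 / 3) ^ (p + 1)) * ENNReal.ofReal 2 := by
        refine ENNReal.tsum_le_tsum fun p => ?_
        gcongr
        rw [lintegral_add_left measurable_const, lintegral_one, measure_univ]
        calc 1 + ∫⁻ ω, V (k p) ω ∂P ≤ 1 + 1 := by gcongr; exact hV1 _ (hκk p)
          _ = _ := by norm_num
    _ = ENNReal.ofReal 1 := by
        have hs : HasSum (fun p : ℕ => (1 / 3 : ℝ) ^ (p + 1) * 2) 1 := by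
          have h := (hasSum_geometric_of_lt_one (r := (1 / 3 : ℝ)) (by norm_num)
            (by norm_num)).mul_right (2 / 3)
          have h1 : (fun p : ℕ => (1 / 3 : ℝ) ^ (p + 1) * 2) = fun p => (1 / 3) ^ p * (2 / 3) :=
            funext fun p => by rw [pow_succ]; ring
          rw [h1]
          norm_num at h ⊢
          exact h
        simp_rw [← ENNReal.ofReal_mul (show (0 : ℝ) ≤ (1 / 3) ^ (_ + 1) by positivity)]
        rw [← ENNReal.ofReal_tsum_of_nonneg (fun p => by positivity) hs.summable, hs.tsum_eq]
    _ = 1 := ENNReal.ofReal_one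

/-! ### Moments of subgaussian sums. -/

/-- Real and imaginary parts are treated separately, each by |ta|^{2k} / (2k)! ≤ e^{|ta|} ≤ e^{ta} +
e^{-ta}. The four exponentials are those of Re(zw) for z = ±t, ±it. -/
lemma norm_pow_le_sum_exp (w : ℂ) {t : ℝ} (ht : 0 < t) (k : ℕ) :
    ‖w‖ ^ (2 * k) ≤ (2 ^ k * (2 * k).factorial / t ^ (2 * k)) *
      (Real.exp ((t : ℂ) * w).re + Real.exp (((-t : ℝ) : ℂ) * w).re
        + (Real.exp ((t * Complex.I) * w).re + Real.exp ((-t * Complex.I) * w).re)) := by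
  have key : ∀ a : ℝ, a ^ (2 * k) ≤ (2 * k).factorial / t ^ (2 * k) *
      (Real.exp (t * a) + Real.exp (-(t * a))) := fun a => by
    have h1 := Real.pow_div_factorial_le_exp _ (abs_nonneg (t * a)) (2 * k)
    have h2 : Real.exp |t * a| ≤ Real.exp (t * a) + Real.exp (-(t * a)) := Real.exp_abs_le _
    rw [Even.pow_abs (even_two_mul k), mul_pow] at h1
    have h3 := h1.trans h2
    rw [div_le_iff₀ (by positivity)] at h3
    rw [div_mul_eq_mul_div, le_div_iff₀ (by positivity)]
    linarith
  have hre := key w.re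
  have him := key w.im
  have hsq : ‖w‖ ^ (2 * k) ≤ 2 ^ k * (w.re ^ (2 * k) + w.im ^ (2 * k)) := by
    rw [pow_mul, Complex.sq_norm, Complex.normSq_apply, ← sq, ← sq]
    have := add_pow_le (sq_nonneg w.re) (sq_nonneg w.im) k
    rw [← pow_mul, ← pow_mul] at this
    refine this.trans ?_
    have h0 : 0 ≤ w.re ^ (2 * k) + w.im ^ (2 * k) :=
      add_nonneg (Even.pow_nonneg (even_two_mul k) _) (Even.pow_nonneg (even_two_mul k) _)
    gcongr
    · norm_num
    · omega
  have e1 : ((t : ℂ) * w).re = t * w.re := by simp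
  have e2 : (((-t : ℝ) : ℂ) * w).re = -(t * w.re) := by simp
  have e3 : ((t * Complex.I) * w).re = -(t * w.im) := by simp
  have e4 : ((-t * Complex.I) * w).re = t * w.im := by simp
  rw [e1, e2, e3, e4]
  refine hsq.trans ?_
  calc _ ≤ 2 ^ k * ((2 * k).factorial / t ^ (2 * k) *
        (Real.exp (t * w.re) + Real.exp (-(t * w.re))) + (2 * k).factorial / t ^ (2 * k) *
        (Real.exp (t * w.im) + Real.exp (-(t * w.im)))) := by gcongr
    _ = _ := by ring

/-- Even moments of a subgaussian complex random variable. -/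
lemma lintegral_norm_pow_le_of_subgaussian {Ω : Type*} [MeasurableSpace Ω] {P : Measure Ω}
    {g : Ω → ℂ} (hg : AEMeasurable g P) {τ : ℝ} (hτ : 0 < τ)
    (h : ∀ z : ℂ, ∫⁻ ω, ENNReal.ofReal (Real.exp (z * g ω).re) ∂P
      ≤ ENNReal.ofReal (Real.exp (τ ^ 2 * ‖z‖ ^ 2 / 2))) {k : ℕ} (hk : 0 < k) :
    ∫⁻ ω, ENNReal.ofReal (‖g ω‖ ^ (2 * k)) ∂P ≤ ENNReal.ofReal ((48 * k * τ ^ 2) ^ k) := by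
  have hk' : (0 : ℝ) < k := by exact_mod_cast hk
  -- This t minimises exp(τ²t²/2) / t^{2k}; the exponent becomes k.
  set t : ℝ := √(2 * k) / τ with ht
  have ht0 : 0 < t := by positivity
  have ht2 : t ^ 2 = 2 * k / τ ^ 2 := by rw [ht, div_pow, Real.sq_sqrt (by positivity)]
  set c : ℝ := 2 ^ k * (2 * k).factorial / t ^ (2 * k) with hc
  have hc0 : 0 ≤ c := by positivity
  have hm : ∀ z : ℂ, AEMeasurable (fun ω => ENNReal.ofReal (Real.exp (z * g ω).re)) P := fun z =>
    (Real.measurable_exp.comp_aemeasurable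
      (Complex.measurable_re.comp_aemeasurable (hg.const_mul z))).ennreal_ofReal
  have hE : ∀ z : ℂ, ‖z‖ = t → ∫⁻ ω, ENNReal.ofReal (Real.exp (z * g ω).re) ∂P
      ≤ ENNReal.ofReal (Real.exp k) := fun z hz => by
    refine (h z).trans (ENNReal.ofReal_le_ofReal (Real.exp_le_exp.2 ?_))
    rw [hz, ht2]
    field_simp
    rfl
  calc _ ≤ ∫⁻ ω, ENNReal.ofReal c * ((ENNReal.ofReal (Real.exp ((t : ℂ) * g ω).re)
          + ENNReal.ofReal (Real.exp (((-t : ℝ) : ℂ) * g ω).re))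
          + (ENNReal.ofReal (Real.exp ((t * Complex.I) * g ω).re)
          + ENNReal.ofReal (Real.exp ((-t * Complex.I) * g ω).re))) ∂P := by
        refine lintegral_mono fun ω => ?_
        rw [← ENNReal.ofReal_add (by positivity) (by positivity),
          ← ENNReal.ofReal_add (by positivity) (by positivity),
          ← ENNReal.ofReal_add (by positivity) (by positivity), ← ENNReal.ofReal_mul hc0]
        exact ENNReal.ofReal_le_ofReal (norm_pow_le_sum_exp (g ω) ht0 k)
    _ = ENNReal.ofReal c * ((∫⁻ ω, ENNReal.ofReal (Real.exp ((t : ℂ) * g ω).re) ∂P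
          + ∫⁻ ω, ENNReal.ofReal (Real.exp (((-t : ℝ) : ℂ) * g ω).re) ∂P)
          + (∫⁻ ω, ENNReal.ofReal (Real.exp ((t * Complex.I) * g ω).re) ∂P
          + ∫⁻ ω, ENNReal.ofReal (Real.exp ((-t * Complex.I) * g ω).re) ∂P)) := by
        have h1 := hm t
        have h2 := hm (-t : ℝ)
        have h3 := hm (t * Complex.I)
        rw [lintegral_const_mul' _ _ ENNReal.ofReal_ne_top, ← lintegral_add_left' h1,
          ← lintegral_add_left' h3]
        exact congrArg _ (lintegral_add_left' (h1.add h2) _)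
    _ ≤ ENNReal.ofReal c * ((ENNReal.ofReal (Real.exp k) + ENNReal.ofReal (Real.exp k))
          + (ENNReal.ofReal (Real.exp k) + ENNReal.ofReal (Real.exp k))) := by
        gcongr <;> refine hE _ ?_ <;> simp [abs_of_pos ht0]
    _ = ENNReal.ofReal (c * (4 * Real.exp k)) := by
        rw [← ENNReal.ofReal_add (by positivity) (by positivity),
          ← ENNReal.ofReal_add (by positivity) (by positivity), ← ENNReal.ofReal_mul hc0]
        congr 2; ring
    _ ≤ _ := by
        refine ENNReal.ofReal_le_ofReal ?_
        have h1 : ((2 * k).factorial : ℝ) ≤ (4 * k ^ 2) ^ k := by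
          calc ((2 * k).factorial : ℝ) ≤ ((2 * k : ℕ) : ℝ) ^ (2 * k) := by
                exact_mod_cast Nat.factorial_le_pow (2 * k)
            _ = _ := by rw [pow_mul]; push_cast; ring
        have h2 : Real.exp k ≤ 3 ^ k := by
          rw [← mul_one (k : ℝ), Real.exp_nat_mul]
          have := Real.exp_one_lt_d9
          gcongr; linarith
        have h4 : (4 : ℝ) ≤ 4 ^ k := le_self_pow₀ (by norm_num) hk.ne'
        rw [hc, pow_mul t, ht2]
        calc 2 ^ k * ((2 * k).factorial : ℝ) / (2 * k / τ ^ 2) ^ k * (4 * Real.exp k)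
            ≤ 2 ^ k * (4 * k ^ 2) ^ k / (2 * k / τ ^ 2) ^ k * (4 ^ k * 3 ^ k) := by gcongr
          _ = _ := by
            rw [← mul_pow, ← mul_pow, ← div_pow, ← mul_pow]
            congr 1
            field_simp
            ring

/-- The two canonical maps between 𝕜 and ℂ are adjoint for the real pairing Re(zu). Complex test
scalars thereby reduce to scalars of 𝕜, also when 𝕜 is real. -/
lemma re_mul_map {𝕜 : Type*} [RCLike 𝕜] (w : ℂ) (u : 𝕜) :
    (w * RCLike.map 𝕜 ℂ u).re = RCLike.re (RCLike.map ℂ 𝕜 w * u) := by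
  have h := RCLike.I_im' u
  simp only [RCLike.map_apply, RCLike.mul_re, map_add, RCLike.ofReal_re, RCLike.ofReal_im,
    RCLike.mul_im, RCLike.I_re, mul_zero, zero_mul, sub_zero, add_zero, zero_add,
    Complex.mul_re, Complex.add_re, Complex.add_im, Complex.mul_im]
  simp only [RCLike.re_eq_complex_re, RCLike.im_eq_complex_im, RCLike.I_to_complex,
    Complex.coe_algebraMap, Complex.I_re, Complex.I_im, Complex.ofReal_re, Complex.ofReal_im]
  by_cases hu : RCLike.im u = 0
  · simp [hu]
  · simp [mul_right_cancel₀ hu (h.trans (one_mul _).symm)]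

lemma norm_map_le {𝕜 𝕜' : Type*} [RCLike 𝕜] [RCLike 𝕜'] (u : 𝕜) : ‖RCLike.map 𝕜 𝕜' u‖ ≤ ‖u‖ := by
  refine le_of_sq_le_sq ?_ (norm_nonneg _)
  rw [RCLike.norm_sq_eq_def, RCLike.norm_sq_eq_def]
  simp only [RCLike.map_apply, RCLike.mul_re, map_add, RCLike.ofReal_re, RCLike.ofReal_im,
    RCLike.mul_im, RCLike.I_re, mul_zero, zero_mul, sub_zero, add_zero, zero_add]
  rcases RCLike.I_eq_zero_or_im_I_eq_one (K := 𝕜') with h | h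
  · rw [h]; simp; nlinarith [sq_nonneg (RCLike.im u)]
  · rw [h]; simp

lemma HasSubgaussianBound.lintegral_exp_re_le {𝕜 Ω : Type*} [RCLike 𝕜] [MeasurableSpace Ω]
    {P : Measure Ω} {f : Ω → 𝕜} {σ : ℝ} (h : HasSubgaussianBound f P σ) (w : ℂ) :
    ∫⁻ ω, ENNReal.ofReal (Real.exp (w * RCLike.map 𝕜 ℂ (f ω)).re) ∂P
      ≤ ENNReal.ofReal (Real.exp (σ ^ 2 * ‖w‖ ^ 2 / 2)) := by
  simp_rw [re_mul_map]
  refine (h.2 _).trans (ENNReal.ofReal_le_ofReal (Real.exp_le_exp.2 ?_))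
  gcongr
  exact norm_map_le w

/-- Passing to |s| + 1 makes it unnecessary that the infimum `sg` is attained, and gives a positive
parameter. -/
lemma hasSubgaussianBound_of_sg_le {𝕜 Ω : Type*} [RCLike 𝕜] [MeasurableSpace Ω]
    {P : Measure Ω} {f : Ω → 𝕜} {s : ℝ} (hf : IsSubgaussian f P) (hs : sg f P ≤ s) :
    HasSubgaussianBound f P (|s| + 1) := by
  obtain ⟨σ, hσ, hlt⟩ := exists_lt_of_csInf_lt hf
    (show sInf {s : ℝ | HasSubgaussianBound f P s} < |s| + 1 from
      lt_of_le_of_lt hs (by linarith [le_abs_self s]))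
  refine ⟨by positivity, fun z => (hσ.2 z).trans
    (ENNReal.ofReal_le_ofReal (Real.exp_le_exp.2 ?_))⟩
  have := hσ.1
  gcongr

section Moments

variable {𝕜 Ω : Type*} [RCLike 𝕜] [MeasurableSpace 𝕜] [BorelSpace 𝕜] [MeasurableSpace Ω]
  {P : Measure Ω} {K : ℕ} {γ : Fin K → Ω → 𝕜}

lemma aemeasurable_map_sum (hγ : ∀ j, AEMeasurable (γ j) P) (x : Fin K → ℂ) :
    AEMeasurable (fun ω => ∑ j, RCLike.map 𝕜 ℂ (γ j ω) * x j) P :=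
  Finset.aemeasurable_fun_sum _ fun j _ =>
    (((RCLike.map 𝕜 ℂ).continuous.measurable).comp_aemeasurable (hγ j)).mul_const _

/-- Subgaussian bound for linear combinations of independent subgaussian variables. -/
lemma lintegral_exp_sum_le (hγ : ∀ j, AEMeasurable (γ j) P) (hind : iIndepFun γ P) {σ : ℝ}
    (hσ : ∀ j, HasSubgaussianBound (γ j) P σ) (x : Fin K → ℂ) (z : ℂ) :
    ∫⁻ ω, ENNReal.ofReal (Real.exp (z * ∑ j, RCLike.map 𝕜 ℂ (γ j ω) * x j).re) ∂P
      ≤ ENNReal.ofReal (Real.exp (σ ^ 2 * (∑ j, ‖x j‖ ^ 2) * ‖z‖ ^ 2 / 2)) := by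
  set F : Fin K → 𝕜 → ℝ≥0∞ := fun j u =>
    ENNReal.ofReal (Real.exp (z * x j * RCLike.map 𝕜 ℂ u).re) with hF
  have hFm : ∀ j, Measurable (F j) := fun j => by
    have : Continuous fun u : 𝕜 => (z * x j * RCLike.map 𝕜 ℂ u).re := by fun_prop
    exact (Real.measurable_exp.comp this.measurable).ennreal_ofReal
  have hprod : ∀ ω, ENNReal.ofReal (Real.exp (z * ∑ j, RCLike.map 𝕜 ℂ (γ j ω) * x j).re)
      = ∏ j, F j (γ j ω) := fun ω => by
    simp only [hF]
    rw [← ENNReal.ofReal_prod_of_nonneg fun j _ => (Real.exp_pos _).le, ← Real.exp_sum,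
      Finset.mul_sum, Complex.re_sum]
    refine congrArg (fun y => ENNReal.ofReal (Real.exp y)) (Finset.sum_congr rfl fun j _ => ?_)
    exact congrArg Complex.re (by ring)
  -- The product formula for independent variables is applied to measurable modifications of the
  -- γ_j.
  have hae : ∀ᵐ ω ∂P, ∀ j, γ j ω = (hγ j).mk (γ j) ω := ae_all_iff.2 fun j => (hγ j).ae_eq_mk
  have hind' : iIndepFun (fun j => (hγ j).mk (γ j)) P := hind.congr fun j => (hγ j).ae_eq_mk
  calc _ = ∫⁻ ω, ∏ j, F j ((hγ j).mk (γ j) ω) ∂P := by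
        refine lintegral_congr_ae ?_
        filter_upwards [hae] with ω hω
        rw [hprod]
        exact Finset.prod_congr rfl fun j _ => by rw [hω j]
    _ = ∏ j, ∫⁻ ω, F j ((hγ j).mk (γ j) ω) ∂P :=
        lintegral_prod_eq_prod_lintegral_of_indepFun Finset.univ
          (fun j => F j ∘ (hγ j).mk (γ j)) (hind'.comp F hFm)
          fun j => (hFm j).comp (hγ j).measurable_mk
    _ = ∏ j, ∫⁻ ω, F j (γ j ω) ∂P := by
        refine Finset.prod_congr rfl fun j _ => lintegral_congr_ae ?_
        filter_upwards [hae] with ω hω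
        rw [hω j]
    _ ≤ ∏ j, ENNReal.ofReal (Real.exp (σ ^ 2 * ‖z * x j‖ ^ 2 / 2)) :=
        Finset.prod_le_prod' fun j _ => (hσ j).lintegral_exp_re_le (z * x j)
    _ = _ := by
        rw [← ENNReal.ofReal_prod_of_nonneg fun j _ => (Real.exp_pos _).le, ← Real.exp_sum]
        congr 2
        rw [Finset.mul_sum, Finset.sum_mul, Finset.sum_div]
        refine Finset.sum_congr rfl fun j _ => ?_
        rw [norm_mul]; ring

lemma lintegral_norm_sum_pow_le (hγ : ∀ j, AEMeasurable (γ j) P) (hind : iIndepFun γ P) {σ : ℝ}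
    (hσ : ∀ j, HasSubgaussianBound (γ j) P σ) (x : Fin K → ℂ) {τ : ℝ} (hτ : 0 < τ)
    (hx : σ ^ 2 * ∑ j, ‖x j‖ ^ 2 ≤ τ ^ 2) {k : ℕ} (hk : 0 < k) :
    ∫⁻ ω, ENNReal.ofReal (‖∑ j, RCLike.map 𝕜 ℂ (γ j ω) * x j‖ ^ (2 * k)) ∂P
      ≤ ENNReal.ofReal ((48 * k * τ ^ 2) ^ k) := by
  refine lintegral_norm_pow_le_of_subgaussian (aemeasurable_map_sum hγ x) hτ (fun z => ?_) hk
  refine (lintegral_exp_sum_le hγ hind hσ x z).trans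
    (ENNReal.ofReal_le_ofReal (Real.exp_le_exp.2 ?_))
  gcongr

/-- The `2k`-th moments of `∑ γ_j x_j` are bounded by `C k ^ (1 / r) ‖x‖_{S_{r'}}`. -/
def HasMomentBound (γ : Fin K → Ω → 𝕜) (P : Measure Ω) (r C : ℝ) : Prop :=
  ∀ (x : Fin K → ℂ) (B : ℝ), 0 < B → sNorm r x ≤ B → ∀ k : ℕ, 0 < k →
    ∫⁻ ω, ENNReal.ofReal (‖∑ j, RCLike.map 𝕜 ℂ (γ j ω) * x j‖ ^ (2 * k)) ∂P
      ≤ ENNReal.ofReal ((C * (k : ℝ) ^ (1 / r) * B) ^ (2 * k))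

/-- The factor 7 comes from 48 ≤ 7², with 48 the constant of the subgaussian moment bound. -/
lemma hasMomentBound_two (hγ : ∀ j, AEMeasurable (γ j) P) (hind : iIndepFun γ P) {σ : ℝ}
    (hσ0 : 0 < σ) (hσ : ∀ j, HasSubgaussianBound (γ j) P σ) :
    HasMomentBound γ P 2 (7 * σ) := by
  intro x B hB hx k hk
  rw [sNorm, if_pos rfl, EuclideanSpace.norm_eq, Real.sqrt_le_left hB.le] at hx
  refine (lintegral_norm_sum_pow_le hγ hind hσ x (τ := σ * B) (by positivity) ?_ hk).trans
    (ENNReal.ofReal_le_ofReal ?_)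
  · rw [mul_pow]
    gcongr
  · have h : ((k : ℝ) ^ (1 / 2 : ℝ)) ^ 2 = k := by
      rw [← Real.sqrt_eq_rpow, Real.sq_sqrt k.cast_nonneg]
    rw [pow_mul (7 * σ * (k : ℝ) ^ (1 / 2 : ℝ) * B)]
    gcongr
    have e : (7 * σ * (k : ℝ) ^ (1 / 2 : ℝ) * B) ^ 2
        = 49 * (σ * B) ^ 2 * ((k : ℝ) ^ (1 / 2 : ℝ)) ^ 2 := by ring
    rw [e, h]
    have : 0 ≤ (k : ℝ) * (σ * B) ^ 2 := by positivity
    linarith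

end Moments

/-! ### Decreasing rearrangements and weak ℓ_p norms. -/

lemma decRearr_nonneg {K : ℕ} (x : Fin K → ℂ) (k : ℕ) : 0 ≤ decRearr x k :=
  Real.sInf_nonneg fun _ hτ => hτ.1

lemma decRearr_le {K : ℕ} {x : Fin K → ℂ} {k : ℕ} {τ : ℝ} (h0 : 0 ≤ τ)
    (h : (Finset.univ.filter fun i => τ < ‖x i‖).card ≤ k) : decRearr x k ≤ τ :=
  csInf_le ⟨0, fun _ hτ => hτ.1⟩ ⟨h0, h⟩

lemma decRearr_le_of_norm_le {K : ℕ} {x : Fin K → ℂ} {G : ℝ} (h0 : 0 ≤ G) (h : ∀ i, ‖x i‖ ≤ G)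
    (k : ℕ) : decRearr x k ≤ G :=
  decRearr_le h0 <| by
    rw [Finset.filter_false_of_mem fun i _ => not_lt.2 (h i)]
    simp

/-- Only indices k < K matter, as the rearrangement vanishes from K on. This makes the supremum
defining `marcinkiewiczNorm` bounded. -/
lemma rpow_mul_decRearr_le {K : ℕ} {x : Fin K → ℂ} {G p : ℝ} (hp : 0 < p) (h0 : 0 ≤ G)
    (h : ∀ i, ‖x i‖ ≤ G) (k : ℕ) :
    ((k : ℝ) + 1) ^ (1 / p) * decRearr x k ≤ (K : ℝ) ^ (1 / p) * G := by
  rcases lt_or_ge k K with hk | hk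
  · have hk' : (k : ℝ) + 1 ≤ K := by exact_mod_cast hk
    exact mul_le_mul (Real.rpow_le_rpow (by positivity) hk' (by positivity))
      (decRearr_le_of_norm_le h0 h k) (decRearr_nonneg x k) (by positivity)
  · have h1 : decRearr x k ≤ 0 := decRearr_le le_rfl
      ((Finset.card_le_univ _).trans (by simpa using hk))
    rw [le_antisymm h1 (decRearr_nonneg x k), mul_zero]
    positivity

lemma marcinkiewiczNorm_le {K : ℕ} {x : Fin K → ℂ} {G p : ℝ} (hp : 0 < p) (h0 : 0 ≤ G)
    (h : ∀ i, ‖x i‖ ≤ G) : marcinkiewiczNorm p x ≤ (K : ℝ) ^ (1 / p) * G :=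
  ciSup_le (rpow_mul_decRearr_le hp h0 h)

lemma decRearr_le_marcinkiewiczNorm {K : ℕ} (x : Fin K → ℂ) {p : ℝ} (hp : 0 < p) (k : ℕ) :
    decRearr x k ≤ marcinkiewiczNorm p x * ((k : ℝ) + 1) ^ (-(1 / p)) := by
  have hG : ∀ i, ‖x i‖ ≤ ∑ j, ‖x j‖ := fun i =>
    Finset.single_le_sum (f := fun j => ‖x j‖) (fun j _ => norm_nonneg _) (Finset.mem_univ i)
  have h := le_ciSup (f := fun k : ℕ => ((k : ℝ) + 1) ^ (1 / p) * decRearr x k)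
    ⟨_, Set.forall_mem_range.2 (rpow_mul_decRearr_le hp (by positivity) hG)⟩ k
  rw [Real.rpow_neg (by positivity), ← div_eq_mul_inv, le_div_iff₀ (by positivity), mul_comm]
  exact h

/-- An enumeration of a finite family in decreasing order. -/
lemma exists_perm_norm_le_decRearr {K : ℕ} (x : Fin K → ℂ) :
    ∃ e : Equiv.Perm (Fin K), ∀ i, ‖x (e i)‖ ≤ decRearr x i := by
  set f : Fin K → ℝ := fun i => -‖x i‖ with hf
  refine ⟨Tuple.sort f, fun i => ?_⟩
  have hmono := Tuple.monotone_sort f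
  have hG : ∀ i, ‖x i‖ ≤ ∑ j, ‖x j‖ := fun i =>
    Finset.single_le_sum (f := fun j => ‖x j‖) (fun j _ => norm_nonneg _) (Finset.mem_univ i)
  refine le_csInf ⟨∑ j, ‖x j‖, by positivity, ?_⟩ ?_
  · rw [Finset.filter_false_of_mem fun i _ => not_lt.2 (hG i)]
    simp
  · rintro τ ⟨-, hτ⟩
    by_contra! hlt
    have hsub : (Finset.Iic i).map (Tuple.sort f).toEmbedding ⊆
        Finset.univ.filter fun i => τ < ‖x i‖ := fun j hj => by
      obtain ⟨l, hl, rfl⟩ := Finset.mem_map.1 hj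
      have h1 := hmono (Finset.mem_Iic.1 hl)
      simp only [hf, Function.comp_apply, neg_le_neg_iff] at h1
      exact Finset.mem_filter.2 ⟨Finset.mem_univ _, hlt.trans_le h1⟩
    have := Finset.card_le_card hsub
    rw [Finset.card_map, Fin.card_Iic] at this
    omega

/-- Bernoulli's inequality gives a(n+1)^{a-1} ≤ (n+1)^a - n^a, and the sum telescopes. -/
lemma sum_head_rpow_le {a : ℝ} (ha : 0 < a) (ha1 : a ≤ 1) (k n : ℕ) :
    ∑ i ∈ Finset.range n, (if i < k then ((i : ℝ) + 1) ^ (a - 1) else 0) ≤ (k : ℝ) ^ a / a := by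
  suffices h : ∑ i ∈ Finset.range n, (if i < k then ((i : ℝ) + 1) ^ (a - 1) else 0)
      ≤ ((min n k : ℕ) : ℝ) ^ a / a by
    refine h.trans ?_
    gcongr
    exact min_le_right _ _
  induction n with
  | zero => simp [Real.zero_rpow ha.ne']
  | succ n ih =>
    rw [Finset.sum_range_succ]
    by_cases hn : n < k
    · rw [if_pos hn, min_eq_left (Nat.succ_le_of_lt hn)]
      rw [min_eq_left hn.le] at ih
      have hn1 : (0 : ℝ) < (n : ℝ) + 1 := by positivity
      have hb := rpow_one_add_le_one_add_mul_self (s := -(1 / ((n : ℝ) + 1)))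
        (by rw [neg_le_neg_iff, div_le_one hn1]; linarith [n.cast_nonneg (α := ℝ)]) ha.le ha1
      have h1 : (n : ℝ) ^ a ≤ ((n : ℝ) + 1) ^ a - a * ((n : ℝ) + 1) ^ (a - 1) := by
        calc (n : ℝ) ^ a = ((n : ℝ) + 1) ^ a * (1 + -(1 / ((n : ℝ) + 1))) ^ a := by
              have e : 1 + -(1 / ((n : ℝ) + 1)) = n / ((n : ℝ) + 1) := by field_simp; ring
              rw [e, ← Real.mul_rpow hn1.le (by positivity), mul_div_cancel₀ _ hn1.ne']
          _ ≤ ((n : ℝ) + 1) ^ a * (1 + a * -(1 / ((n : ℝ) + 1))) := by gcongr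
          _ = _ := by rw [Real.rpow_sub_one hn1.ne']; ring
      calc _ ≤ (n : ℝ) ^ a / a + ((n : ℝ) + 1) ^ (a - 1) := by gcongr
        _ ≤ (((n : ℝ) + 1) ^ a - a * ((n : ℝ) + 1) ^ (a - 1)) / a + ((n : ℝ) + 1) ^ (a - 1) := by
            gcongr
        _ = _ := by push_cast; field_simp; ring
    · rw [if_neg hn, add_zero, min_eq_right (by omega)]
      rwa [min_eq_right (by omega)] at ih

/-- Telescoping again, from b(n+1)^{-b-1} ≤ n^{-b} - (n+1)^{-b}. The induction keeps the subtracted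
end term. -/
lemma sum_tail_rpow_le {b : ℝ} (hb : 0 < b) {k : ℕ} (hk : 0 < k) (n : ℕ) :
    ∑ i ∈ Finset.range n, (if k ≤ i then ((i : ℝ) + 1) ^ (-b - 1) else 0)
      ≤ (k : ℝ) ^ (-b) / b := by
  have hk' : (0 : ℝ) < k := by exact_mod_cast hk
  suffices h : ∑ i ∈ Finset.range n, (if k ≤ i then ((i : ℝ) + 1) ^ (-b - 1) else 0)
      ≤ ((k : ℝ) ^ (-b) - ((max n k : ℕ) : ℝ) ^ (-b)) / b by
    refine h.trans ?_
    gcongr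
    linarith [Real.rpow_nonneg (Nat.cast_nonneg (α := ℝ) (max n k)) (-b)]
  induction n with
  | zero => simp
  | succ n ih =>
    rw [Finset.sum_range_succ]
    by_cases hn : k ≤ n
    · rw [if_pos hn, max_eq_left (by omega)]
      rw [max_eq_left hn] at ih
      have hn0 : (0 : ℝ) < n := hk'.trans_le (by exact_mod_cast hn)
      have hn1 : (0 : ℝ) < (n : ℝ) + 1 := by positivity
      have h1 : ((n : ℝ) + 1) ^ (-b) + b * ((n : ℝ) + 1) ^ (-b - 1) ≤ (n : ℝ) ^ (-b) := by
        have h2 : 1 + b * (1 / ((n : ℝ) + 1)) ≤ ((n : ℝ) / ((n : ℝ) + 1)) ^ (-b) := by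
          have h3 : (n : ℝ) / ((n : ℝ) + 1) ≤ Real.exp (-(1 / ((n : ℝ) + 1))) := by
            have e : (n : ℝ) / ((n : ℝ) + 1) = -(1 / ((n : ℝ) + 1)) + 1 := by field_simp; ring
            rw [e]; exact Real.add_one_le_exp _
          calc 1 + b * (1 / ((n : ℝ) + 1)) ≤ Real.exp (b * (1 / ((n : ℝ) + 1))) := by
                rw [add_comm]; exact Real.add_one_le_exp _
            _ = Real.exp (-(1 / ((n : ℝ) + 1))) ^ (-b) := by
                rw [← Real.exp_mul]; ring_nf
            _ ≤ _ := Real.rpow_le_rpow_of_nonpos (by positivity) h3 (by linarith)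
        calc _ = ((n : ℝ) + 1) ^ (-b) * (1 + b * (1 / ((n : ℝ) + 1))) := by
              rw [Real.rpow_sub_one hn1.ne']; ring
          _ ≤ ((n : ℝ) + 1) ^ (-b) * ((n : ℝ) / ((n : ℝ) + 1)) ^ (-b) := by gcongr
          _ = _ := by rw [← Real.mul_rpow hn1.le (by positivity), mul_div_cancel₀ _ hn1.ne']
      calc _ ≤ ((k : ℝ) ^ (-b) - (n : ℝ) ^ (-b)) / b + ((n : ℝ) + 1) ^ (-b - 1) := by gcongr
        _ ≤ ((k : ℝ) ^ (-b) - (((n : ℝ) + 1) ^ (-b) + b * ((n : ℝ) + 1) ^ (-b - 1))) / b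
            + ((n : ℝ) + 1) ^ (-b - 1) := by gcongr
        _ = _ := by push_cast; field_simp; ring
    · rw [if_neg hn, add_zero, max_eq_right (by omega)]
      rwa [max_eq_right (by omega)] at ih

/-- Splitting of a vector of `ℓ_{r',∞}` into its `k` largest coordinates and the rest. -/
lemma exists_split_of_marcinkiewiczNorm_le {K : ℕ} (x : Fin K → ℂ) {r B : ℝ} (hr : 2 < r)
    (hB : 0 < B) (hx : marcinkiewiczNorm (r / (r - 1)) x ≤ B) {k : ℕ} (hk : 0 < k) :
    ∃ y w : Fin K → ℂ, (∀ j, x j = y j + w j) ∧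
      ∑ j, ‖y j‖ ≤ r * (B * (k : ℝ) ^ (1 / r)) ∧
      ∑ j, ‖w j‖ ^ 2 ≤ r / (r - 2) * (B * (k : ℝ) ^ (1 / r)) ^ 2 / k := by
  have hr0 : 0 < r := by linarith
  have hk' : (0 : ℝ) < k := by exact_mod_cast hk
  obtain ⟨e, he⟩ := exists_perm_norm_le_decRearr x
  have hexp : -(1 / (r / (r - 1))) = 1 / r - 1 := by
    have : r - 1 ≠ 0 := by linarith
    field_simp; ring
  have hxe : ∀ i : Fin K, ‖x (e i)‖ ≤ B * ((i : ℝ) + 1) ^ (1 / r - 1) := fun i => by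
    refine (he i).trans ((decRearr_le_marcinkiewiczNorm x
      (p := r / (r - 1)) (div_pos hr0 (by linarith)) i).trans ?_)
    rw [hexp]
    gcongr
  refine ⟨fun j => if (e.symm j : ℕ) < k then x j else 0,
    fun j => if k ≤ (e.symm j : ℕ) then x j else 0, fun j => ?_, ?_, ?_⟩
  · by_cases h : (e.symm j : ℕ) < k
    · simp [h]
    · simp [h, not_lt.1 h]
  · rw [← Equiv.sum_comp e]
    simp only [Equiv.symm_apply_apply]
    calc _ ≤ ∑ i : Fin K, B * (if (i : ℕ) < k then ((i : ℝ) + 1) ^ (1 / r - 1) else 0) := by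
          refine Finset.sum_le_sum fun i _ => ?_
          split_ifs
          · exact hxe i
          · simp
      _ = B * ∑ i ∈ Finset.range K, (if i < k then ((i : ℝ) + 1) ^ (1 / r - 1) else 0) := by
          rw [← Finset.mul_sum, Finset.sum_range]
      _ ≤ B * ((k : ℝ) ^ (1 / r) / (1 / r)) := by
          gcongr
          exact sum_head_rpow_le (by positivity)
            ((div_le_one hr0).2 (by linarith)) k K
      _ = _ := by field_simp
  · rw [← Equiv.sum_comp e]
    simp only [Equiv.symm_apply_apply]
    -- Here r > 2 is essential: the squared tail decays like i^{2/r-2}, which is summable only if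
    -- 2/r < 1.
    have hb : 0 < 1 - 2 / r := by rw [sub_pos, div_lt_one hr0]; exact hr
    calc _ ≤ ∑ i : Fin K, B ^ 2 *
            (if k ≤ (i : ℕ) then ((i : ℝ) + 1) ^ (-(1 - 2 / r) - 1) else 0) := by
          refine Finset.sum_le_sum fun i _ => ?_
          split_ifs
          · calc ‖x (e i)‖ ^ 2 ≤ (B * ((i : ℝ) + 1) ^ (1 / r - 1)) ^ 2 := by
                  gcongr; exact hxe i
              _ = _ := by
                  rw [mul_pow, ← Real.rpow_mul_natCast (by positivity)]
                  congr 2; push_cast; ring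
          · simp
      _ = B ^ 2 * ∑ i ∈ Finset.range K,
            (if k ≤ i then ((i : ℝ) + 1) ^ (-(1 - 2 / r) - 1) else 0) := by
          rw [← Finset.mul_sum, Finset.sum_range]
      _ ≤ B ^ 2 * ((k : ℝ) ^ (-(1 - 2 / r)) / (1 - 2 / r)) := by
          gcongr
          exact sum_tail_rpow_le hb hk K
      _ = _ := by
          have h1 : (k : ℝ) ^ (-(1 - 2 / r)) = ((k : ℝ) ^ (1 / r)) ^ 2 / k := by
            rw [← Real.rpow_mul_natCast hk'.le, ← Real.rpow_sub_one hk'.ne']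
            congr 1; push_cast; ring
          have h2 : r - 2 ≠ 0 := by linarith
          rw [h1, mul_pow]
          have h3 : 1 - 2 / r = (r - 2) / r := by field_simp
          rw [h3]
          field_simp

/-! ### Moments of bounded subgaussian sums for r > 2. -/

section BoundedMoments

variable {𝕜 Ω : Type*} [RCLike 𝕜] [MeasurableSpace 𝕜] [BorelSpace 𝕜] [MeasurableSpace Ω]
  {P : Measure Ω} [IsProbabilityMeasure P] {K : ℕ} {γ : Fin K → Ω → 𝕜}

/-- The vector is cut at the moment order k. Its k largest coordinates have ℓ_1 norm of order
k^{1/r} B and are handled by the uniform bound M. The rest has ℓ_2 norm of order k^{1/r-1/2} B, and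
the subgaussian factor √k restores k^{1/r} B. -/
lemma hasMomentBound_of_bounded (hγ : ∀ j, AEMeasurable (γ j) P) (hind : iIndepFun γ P) {σ M r : ℝ}
    (hσ0 : 0 < σ) (hσ : ∀ j, HasSubgaussianBound (γ j) P σ) (hM0 : 0 ≤ M)
    (hM : ∀ j, ∀ᵐ ω ∂P, ‖γ j ω‖ ≤ M) (hr : 2 < r) :
    HasMomentBound γ P r (2 * √((M * r) ^ 2 + 48 * (σ ^ 2 * (r / (r - 2))))) := by
  intro x B hB hx k hk
  rw [sNorm, if_neg hr.ne'] at hx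
  obtain ⟨y, w, hxyw, hy, hw⟩ := exists_split_of_marcinkiewiczNorm_le x hr hB hx hk
  have hr2 : 0 < r - 2 := by linarith
  have hr0 : 0 < r := by linarith
  have hk' : (0 : ℝ) < k := by exact_mod_cast hk
  set D : ℝ := B * (k : ℝ) ^ (1 / r) with hD
  have hD0 : 0 < D := by positivity
  set c : ℝ := r / (r - 2) with hc
  have hc0 : 0 < c := by positivity
  have hτ : 0 < √(σ ^ 2 * c * D ^ 2 / k) := by positivity
  have htail := lintegral_norm_sum_pow_le hγ hind hσ w hτ (by
    rw [Real.sq_sqrt (by positivity)]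
    calc σ ^ 2 * ∑ j, ‖w j‖ ^ 2 ≤ σ ^ 2 * (c * D ^ 2 / k) := by gcongr
      _ = _ := by ring) hk
  rw [Real.sq_sqrt (by positivity)] at htail
  have hpt : ∀ᵐ ω ∂P, ENNReal.ofReal (‖∑ j, RCLike.map 𝕜 ℂ (γ j ω) * x j‖ ^ (2 * k))
      ≤ ENNReal.ofReal (4 ^ k) * (ENNReal.ofReal ((M * (r * D)) ^ (2 * k))
        + ENNReal.ofReal (‖∑ j, RCLike.map 𝕜 ℂ (γ j ω) * w j‖ ^ (2 * k))) := by
    filter_upwards [ae_all_iff.2 hM] with ω hω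
    rw [← ENNReal.ofReal_add (by positivity) (by positivity), ← ENNReal.ofReal_mul (by positivity)]
    refine ENNReal.ofReal_le_ofReal ?_
    have h1 : ‖∑ j, RCLike.map 𝕜 ℂ (γ j ω) * y j‖ ≤ M * (r * D) := by
      calc _ ≤ ∑ j, M * ‖y j‖ := by
            refine norm_sum_le_of_le _ fun j _ => ?_
            rw [norm_mul]
            gcongr
            exact (norm_map_le _).trans (hω j)
        _ ≤ _ := by rw [← Finset.mul_sum]; gcongr
    have h2 : ‖∑ j, RCLike.map 𝕜 ℂ (γ j ω) * x j‖
        ≤ M * (r * D) + ‖∑ j, RCLike.map 𝕜 ℂ (γ j ω) * w j‖ := by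
      simp_rw [hxyw, mul_add, Finset.sum_add_distrib]
      exact (norm_add_le _ _).trans (by gcongr)
    calc _ ≤ (M * (r * D) + ‖∑ j, RCLike.map 𝕜 ℂ (γ j ω) * w j‖) ^ (2 * k) := by gcongr
      _ ≤ 2 ^ (2 * k - 1) * _ := add_pow_le (by positivity) (norm_nonneg _) _
      _ ≤ 4 ^ k * _ := by
          gcongr
          calc (2 : ℝ) ^ (2 * k - 1) ≤ 2 ^ (2 * k) := pow_le_pow_right₀ (by norm_num) (by omega)
            _ = 4 ^ k := by rw [pow_mul]; norm_num
  calc _ ≤ ∫⁻ ω, ENNReal.ofReal (4 ^ k) * (ENNReal.ofReal ((M * (r * D)) ^ (2 * k))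
        + ENNReal.ofReal (‖∑ j, RCLike.map 𝕜 ℂ (γ j ω) * w j‖ ^ (2 * k))) ∂P :=
        lintegral_mono_ae hpt
    _ = ENNReal.ofReal (4 ^ k) * (ENNReal.ofReal ((M * (r * D)) ^ (2 * k))
        + ∫⁻ ω, ENNReal.ofReal (‖∑ j, RCLike.map 𝕜 ℂ (γ j ω) * w j‖ ^ (2 * k)) ∂P) := by
        rw [lintegral_const_mul' _ _ ENNReal.ofReal_ne_top, lintegral_add_left measurable_const,
          lintegral_const, measure_univ, mul_one]
    _ ≤ ENNReal.ofReal (4 ^ k) * (ENNReal.ofReal ((M * (r * D)) ^ (2 * k))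
        + ENNReal.ofReal ((48 * k * (σ ^ 2 * c * D ^ 2 / k)) ^ k)) := by gcongr
    _ ≤ _ := by
        rw [← ENNReal.ofReal_add (by positivity) (by positivity),
          ← ENNReal.ofReal_mul (by positivity)]
        refine ENNReal.ofReal_le_ofReal ?_
        have e1 : 48 * k * (σ ^ 2 * c * D ^ 2 / k) = 48 * (σ ^ 2 * c) * D ^ 2 := by field_simp
        have e2 : (2 * √((M * r) ^ 2 + 48 * (σ ^ 2 * c)) * (k : ℝ) ^ (1 / r) * B) ^ (2 * k)
            = 4 ^ k * ((M * r) ^ 2 * D ^ 2 + 48 * (σ ^ 2 * c) * D ^ 2) ^ k := by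
          have e3 : 2 * √((M * r) ^ 2 + 48 * (σ ^ 2 * c)) * (k : ℝ) ^ (1 / r) * B
            = 2 * (√((M * r) ^ 2 + 48 * (σ ^ 2 * c)) * D) := by rw [hD]; ring
          rw [e3, pow_mul, mul_pow, mul_pow √_, Real.sq_sqrt (by positivity), ← mul_pow]
          congr 1; ring
        have e4 : (M * (r * D)) ^ (2 * k) = ((M * r) ^ 2 * D ^ 2) ^ k := by
          rw [pow_mul]; congr 1; ring
        rw [e1, e2, e4]
        gcongr
        exact pow_add_pow_le (by positivity) (by positivity) hk.ne'

end BoundedMoments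

/-! ### Dirichlet polynomials on the imaginary axis. -/

lemma sum_mul_mem_dirichletPolynomials {A : Finset ℕ} {K : ℕ} {D : Fin K → ℂ → ℂ}
    (hD : ∀ j, D j ∈ dirichletPolynomials A) (u : Fin K → ℂ) :
    (fun w => ∑ j, u j * D j w) ∈ dirichletPolynomials A := by
  choose a ha using hD
  refine ⟨fun n => ∑ j, u j * a j n, fun w => ?_⟩
  simp_rw [ha, Finset.mul_sum, Finset.sum_mul]
  rw [Finset.sum_comm]
  exact Finset.sum_congr rfl fun n _ => Finset.sum_congr rfl fun j _ => (mul_assoc _ _ _).symm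

lemma exists_norm_le_of_mem_dirichletPolynomials {A : Finset ℕ} (hA : ∀ n ∈ A, 0 < n) {D : ℂ → ℂ}
    (hD : D ∈ dirichletPolynomials A) :
    ∃ G : ℝ, 0 ≤ G ∧ ∀ t : ℝ, ‖D (t * Complex.I)‖ ≤ G := by
  obtain ⟨a, ha⟩ := hD
  refine ⟨∑ n ∈ A, ‖a n‖, by positivity, fun t => ?_⟩
  rw [ha]
  refine norm_sum_le_of_le _ fun n hn => ?_
  rw [norm_mul, Complex.norm_natCast_cpow_of_pos (hA n hn)]
  simp

lemma sNorm_nonneg {K : ℕ} (r : ℝ) (x : Fin K → ℂ) : 0 ≤ sNorm r x := by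
  unfold sNorm
  split_ifs
  · positivity
  · exact Real.iSup_nonneg fun k => mul_nonneg (by positivity) (decRearr_nonneg x k)

/-- A real `⨆` over an unbounded range is 0 by convention, so boundedness is needed before values at
single points can be compared with it. -/
lemma bddAbove_sNorm {A : Finset ℕ} (hA : ∀ n ∈ A, 0 < n) {K : ℕ} {D : Fin K → ℂ → ℂ}
    (hD : ∀ j, D j ∈ dirichletPolynomials A) {r : ℝ} (hr : 1 < r) :
    BddAbove (Set.range fun t : ℝ => sNorm r fun j => D j (t * Complex.I)) := by
  choose G hG0 hG using fun j => exists_norm_le_of_mem_dirichletPolynomials hA (hD j)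
  have hle : ∀ j, G j ≤ ∑ i, G i := fun j =>
    Finset.single_le_sum (fun i _ => hG0 i) (Finset.mem_univ j)
  have h0 : 0 ≤ ∑ i, G i := Finset.sum_nonneg fun i _ => hG0 i
  by_cases hr2 : r = 2
  · refine ⟨√(∑ j, G j ^ 2), Set.forall_mem_range.2 fun t => ?_⟩
    rw [sNorm, if_pos hr2, EuclideanSpace.norm_eq]
    refine Real.sqrt_le_sqrt (Finset.sum_le_sum fun j _ => ?_)
    gcongr
    exact hG j t
  · refine ⟨(K : ℝ) ^ (1 / (r / (r - 1))) * ∑ i, G i, Set.forall_mem_range.2 fun t => ?_⟩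
    rw [sNorm, if_neg hr2]
    exact marcinkiewiczNorm_le (div_pos (by linarith) (by linarith)) h0
      fun j => (hG j t).trans (hle j)

open scoped Pointwise in
/-- The supremum of a Dirichlet polynomial is controlled by its `2k`-th mean over finitely many
points, up to the cardinality of `A ^ k`. -/
lemma exists_sampling_pow (A : Finset ℕ) (hA : ∀ n ∈ A, 0 < n) {k : ℕ} (hk : 0 < k) :
    ∃ (L : ℕ) (τ : ℕ → ℝ), 0 < L ∧ ∀ D ∈ dirichletPolynomials A,
      (⨆ t : ℝ, ‖D (t * Complex.I)‖) ^ (2 * k) ≤ 2 * (A ^ k).card *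
        ((1 / (L : ℝ)) * ∑ l ∈ Finset.range L, ‖D (τ l * Complex.I)‖ ^ (2 * k)) := by
  obtain ⟨L, τ, hL, h⟩ := exists_sampling (A ^ k) fun n hn =>
    Nat.pos_of_ne_zero (Nat.ne_zero_of_mem_smoothNumbers (mem_pow_smooth A hA k n hn).1)
  refine ⟨L, τ, hL, fun D ⟨a, ha⟩ => ?_⟩
  obtain ⟨c, hc⟩ := exists_pow_dirichlet A a k
  have hpow : ∀ t : ℝ, ‖∑ n ∈ A ^ k, c n * (n : ℂ) ^ (-(t * Complex.I))‖ ^ 2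
      = ‖D (t * Complex.I)‖ ^ (2 * k) := fun t => by
    rw [← hc, ← ha, norm_pow, ← pow_mul, mul_comm k 2]
  have h1 := h c
  simp only [hpow] at h1
  set Y := 2 * ((A ^ k).card : ℝ) *
    ((1 / (L : ℝ)) * ∑ l ∈ Finset.range L, ‖D (τ l * Complex.I)‖ ^ (2 * k))
  have hY : 0 ≤ Y := by positivity
  have h2k : 2 * k ≠ 0 := by positivity
  calc _ ≤ (Y ^ (((2 * k : ℕ) : ℝ)⁻¹)) ^ (2 * k) := by
        refine pow_le_pow_left₀ (Real.iSup_nonneg fun t => norm_nonneg _) (ciSup_le fun t => ?_) _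
        rw [Real.le_rpow_inv_iff_of_pos (norm_nonneg _) hY (by positivity), Real.rpow_natCast]
        exact h1 t
    _ = Y := Real.rpow_inv_natCast_pow hY h2k

lemma ae_norm_le_of_eLpNorm_top_le {𝕜 Ω : Type*} [RCLike 𝕜] [MeasurableSpace Ω] {P : Measure Ω}
    {f : Ω → 𝕜} {M : ℝ}
    (h : eLpNorm f ⊤ P ≤ ENNReal.ofReal M) : ∀ᵐ ω ∂P, ‖f ω‖ ≤ |M| := by
  rw [eLpNorm_exponent_top] at h
  filter_upwards [ae_le_eLpNormEssSup (f := f) (μ := P)] with ω hω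
  have h1 := hω.trans (h.trans (ENNReal.ofReal_le_ofReal (le_abs_self M)))
  rwa [← ofReal_norm, ENNReal.ofReal_le_ofReal_iff (abs_nonneg M)] at h1

/-! ### The random supremum. -/

section OrliczBound

variable {𝕜 Ω : Type*} [RCLike 𝕜] [MeasurableSpace 𝕜] [BorelSpace 𝕜] [MeasurableSpace Ω]
  {P : Measure Ω} [IsProbabilityMeasure P] {K : ℕ} {γ : Fin K → Ω → 𝕜}

lemma orliczNorm_randomSup_le (hγ : ∀ j, AEMeasurable (γ j) P) {r C : ℝ} (hr : 1 < r) (hC : 0 < C)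
    (hmom : HasMomentBound γ P r C) {A : Finset ℕ} (hA : ∀ n ∈ A, 0 < n) {D : Fin K → ℂ → ℂ}
    (hD : ∀ j, D j ∈ dirichletPolynomials A) :
    orliczNorm (expOrlicz r) (randomSup γ D) P
      ≤ ENNReal.ofReal (Real.exp 2 * C * (18 * ⌈r⌉₊) ^ (1 / r) * kszBound r A D) := by
  have hr0 : 0 < r := by linarith
  set Λ : ℝ := 1 + (maxPrimeCount A : ℝ) * (1 + 20 * Real.log (maxPrimeFactors A)) with hΛ
  have hΛ1 : 1 ≤ Λ := by
    have : 0 ≤ Real.log (maxPrimeFactors A) := Real.log_natCast_nonneg _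
    have : 0 ≤ (maxPrimeCount A : ℝ) * (1 + 20 * Real.log (maxPrimeFactors A)) := by positivity
    linarith
  set B₀ : ℝ := ⨆ t : ℝ, sNorm r fun j => D j (t * Complex.I) with hB₀
  have hB₀0 : 0 ≤ B₀ := Real.iSup_nonneg fun t => sNorm_nonneg _ _
  have hκ : 0 < ⌈Λ⌉₊ := Nat.ceil_pos.2 (by linarith)
  have hκΛ : (⌈Λ⌉₊ : ℝ) ≤ 2 * Λ := by linarith [Nat.ceil_lt_add_one (show 0 ≤ Λ by linarith)]
  have hX : ∀ ω, 0 ≤ randomSup γ D ω := fun ω => Real.iSup_nonneg fun t => norm_nonneg _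
  -- The moment and Orlicz bounds need a positive scale, but B₀ may vanish; hence B₀ + δ, with δ → 0
  -- at the end.
  have key : ∀ δ : ℝ, 0 < δ → orliczNorm (expOrlicz r) (randomSup γ D) P
      ≤ ENNReal.ofReal (Real.exp 2 * C * (18 * ⌈r⌉₊) ^ (1 / r) * (Λ ^ (1 / r) * (B₀ + δ))) := by
    intro δ hδ
    have hB : 0 < B₀ + δ := by linarith
    refine (orliczNorm_expOrlicz_le hX hr.le (R := Real.exp 2 * C * (B₀ + δ)) (by positivity) hκ
      fun k hk => ?_).trans (ENNReal.ofReal_le_ofReal ?_)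
    · have hk0 : 0 < k := hκ.trans_le hk
      have hk0' : (0 : ℝ) < k := by exact_mod_cast hk0
      obtain ⟨L, τ, hL, hsamp⟩ := exists_sampling_pow A hA hk0
      have hL' : (0 : ℝ) < L := by exact_mod_cast hL
      have hcard := two_mul_card_pow_le A hA k ((Nat.le_ceil Λ).trans (by exact_mod_cast hk))
      set c : ℝ := C * (k : ℝ) ^ (1 / r) * (B₀ + δ) with hc
      have hc0 : 0 < c := by positivity
      have hm : ∀ t : ℝ, AEMeasurable (fun ω => ENNReal.ofReal
          (‖∑ j, RCLike.map 𝕜 ℂ (γ j ω) * D j (t * Complex.I)‖ ^ (2 * k))) P := fun t =>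
        ((aemeasurable_map_sum hγ _).norm.pow_const _).ennreal_ofReal
      -- The majorant is the sample mean of the 2k-th powers divided by c^(2k). The moment bound at
      -- each fixed sample point makes its integral at most 1.
      refine ⟨fun ω => ENNReal.ofReal (1 / (L * c ^ (2 * k))) * ∑ l ∈ Finset.range L,
        ENNReal.ofReal (‖∑ j, RCLike.map 𝕜 ℂ (γ j ω) * D j (τ l * Complex.I)‖ ^ (2 * k)),
        (Finset.aemeasurable_fun_sum _ fun l _ => hm (τ l)).const_mul _, ?_, fun ω => ?_⟩
      · rw [lintegral_const_mul' _ _ ENNReal.ofReal_ne_top,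
          lintegral_finsetSum' _ fun l _ => hm (τ l)]
        calc _ ≤ ENNReal.ofReal (1 / (L * c ^ (2 * k))) *
              ∑ l ∈ Finset.range L, ENNReal.ofReal (c ^ (2 * k)) := by
              gcongr with l
              exact hmom _ _ hB ((le_ciSup (bddAbove_sNorm hA hD hr) (τ l)).trans
                (by linarith)) k hk0
          _ = 1 := by
              rw [← ENNReal.ofReal_sum_of_nonneg fun _ _ => by positivity,
                ← ENNReal.ofReal_mul (by positivity), ← ENNReal.ofReal_one]
              congr 1
              rw [Finset.sum_const, Finset.card_range, nsmul_eq_mul]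
              field_simp
      · beta_reduce
        rw [← ENNReal.ofReal_sum_of_nonneg fun _ _ => by positivity,
          ← ENNReal.ofReal_mul (by positivity)]
        refine ENNReal.ofReal_le_ofReal ?_
        have h1 := hsamp _ (sum_mul_mem_dirichletPolynomials hD fun j => RCLike.map 𝕜 ℂ (γ j ω))
        change randomSup γ D ω ^ (2 * k) ≤ _ at h1
        set Z := ∑ l ∈ Finset.range L,
          ‖∑ j, RCLike.map 𝕜 ℂ (γ j ω) * D j (τ l * Complex.I)‖ ^ (2 * k)
        have hZ : 0 ≤ Z := by positivity
        have e : Real.exp 2 * C * (B₀ + δ) * (k : ℝ) ^ (1 / r) = Real.exp 2 * c := by rw [hc]; ring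
        rw [e, div_pow, div_le_iff₀ (by positivity), mul_pow (Real.exp 2) c]
        have hcp : 0 < c ^ (2 * k) := by positivity
        generalize c ^ (2 * k) = q at hcp ⊢
        calc _ ≤ Real.exp 2 ^ (2 * k) * (1 / (L : ℝ) * Z) := h1.trans (by gcongr)
          _ = _ := by generalize Real.exp 2 ^ (2 * k) = q'; field_simp
    · have h1 : (9 * (⌈r⌉₊ : ℝ) * ⌈Λ⌉₊) ^ (1 / r) ≤ (18 * ⌈r⌉₊) ^ (1 / r) * Λ ^ (1 / r) := by
        rw [← Real.mul_rpow (by positivity) (by linarith)]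
        refine Real.rpow_le_rpow (by positivity) ?_ (by positivity)
        calc 9 * (⌈r⌉₊ : ℝ) * ⌈Λ⌉₊ ≤ 9 * ⌈r⌉₊ * (2 * Λ) := by gcongr
          _ = _ := by ring
      calc _ ≤ Real.exp 2 * C * (B₀ + δ) * ((18 * ⌈r⌉₊) ^ (1 / r) * Λ ^ (1 / r)) := by gcongr
        _ = _ := by ring
  have hlim : Filter.Tendsto (fun δ : ℝ => ENNReal.ofReal
      (Real.exp 2 * C * (18 * ⌈r⌉₊) ^ (1 / r) * (Λ ^ (1 / r) * (B₀ + δ))))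
      (nhdsWithin 0 (Set.Ioi 0))
      (nhds (ENNReal.ofReal (Real.exp 2 * C * (18 * ⌈r⌉₊) ^ (1 / r) * kszBound r A D))) := by
    refine (ENNReal.continuous_ofReal.tendsto _).comp (tendsto_nhdsWithin_of_tendsto_nhds ?_)
    have h : Continuous fun δ : ℝ =>
        Real.exp 2 * C * (18 * ⌈r⌉₊) ^ (1 / r) * (Λ ^ (1 / r) * (B₀ + δ)) := by fun_prop
    have := h.tendsto 0
    rwa [add_zero] at this
  exact ge_of_tendsto hlim (by filter_upwards [self_mem_nhdsWithin] with δ hδ using key δ hδ)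

end OrliczBound

end KSZ

end

theorem mainTheorem6 :
    -- the case `r = 2`, with a constant depending only on `s`
    (∀ s : ℝ, ∃ C : ℝ, 0 < C ∧
      ∀ (𝕜 : Type) [RCLike 𝕜] [MeasurableSpace 𝕜] [BorelSpace 𝕜]
        (Ω : Type*) [MeasurableSpace Ω] (P : Measure Ω) [IsProbabilityMeasure P]
        (K : ℕ) (γ : Fin K → Ω → 𝕜),
        (∀ j, AEMeasurable (γ j) P) → iIndepFun γ P →
        (∀ j, KSZ.IsSubgaussian (γ j) P) → (∀ j, KSZ.sg (γ j) P ≤ s) →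
        ∀ A : Finset ℕ, (∀ n ∈ A, 0 < n) →
        ∀ D : Fin K → ℂ → ℂ, (∀ j, D j ∈ KSZ.dirichletPolynomials A) →
          KSZ.orliczNorm (KSZ.expOrlicz 2) (KSZ.randomSup γ D) P
            ≤ ENNReal.ofReal (C * KSZ.kszBound 2 A D)) ∧
    -- the case `2 < r < ∞`, with a constant depending only on `r`, `s` and `M`
    (∀ r : ℝ, 2 < r → ∀ s M : ℝ, ∃ C : ℝ, 0 < C ∧
      ∀ (𝕜 : Type) [RCLike 𝕜] [MeasurableSpace 𝕜] [BorelSpace 𝕜]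
        (Ω : Type*) [MeasurableSpace Ω] (P : Measure Ω) [IsProbabilityMeasure P]
        (K : ℕ) (γ : Fin K → Ω → 𝕜),
        (∀ j, AEMeasurable (γ j) P) → iIndepFun γ P →
        (∀ j, KSZ.IsSubgaussian (γ j) P) → (∀ j, KSZ.sg (γ j) P ≤ s) →
        (∀ j, eLpNorm (γ j) ⊤ P ≤ ENNReal.ofReal M) →
        ∀ A : Finset ℕ, (∀ n ∈ A, 0 < n) →
        ∀ D : Fin K → ℂ → ℂ, (∀ j, D j ∈ KSZ.dirichletPolynomials A) →
          KSZ.orliczNorm (KSZ.expOrlicz r) (KSZ.randomSup γ D) P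
            ≤ ENNReal.ofReal (C * KSZ.kszBound r A D)) := by
  refine ⟨fun s => ⟨Real.exp 2 * (7 * (|s| + 1)) * (18 * ⌈(2 : ℝ)⌉₊) ^ (1 / 2 : ℝ),
    by positivity, ?_⟩, fun r hr s M => ?_⟩
  · intro 𝕜 _ _ _ Ω _ P _ K γ hγ hind hsub hs A hA D hD
    exact KSZ.orliczNorm_randomSup_le hγ one_lt_two (by positivity)
      (KSZ.hasMomentBound_two hγ hind (by positivity)
        fun j => KSZ.hasSubgaussianBound_of_sg_le (hsub j) (hs j)) hA hD
  · have hr2 : 0 < r - 2 := by linarith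
    have hr0 : 0 < r := by linarith
    have hC : 0 < 2 * √((|M| * r) ^ 2 + 48 * ((|s| + 1) ^ 2 * (r / (r - 2)))) := by positivity
    refine ⟨Real.exp 2 * (2 * √((|M| * r) ^ 2 + 48 * ((|s| + 1) ^ 2 * (r / (r - 2))))) *
      (18 * ⌈r⌉₊) ^ (1 / r), by positivity, ?_⟩
    intro 𝕜 _ _ _ Ω _ P _ K γ hγ hind hsub hs hM A hA D hD
    exact KSZ.orliczNorm_randomSup_le hγ (by linarith) hC
      (KSZ.hasMomentBound_of_bounded hγ hind (by positivity)
        (fun j => KSZ.hasSubgaussianBound_of_sg_le (hsub j) (hs j)) (abs_nonneg M)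
        (fun j => KSZ.ae_norm_le_of_eLpNorm_top_le (hM j)) hr) hA hD
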